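/- Let $d\ge 2$, $0\le r_0<r_1\le\infty$, $A(r_0,r_1)=\{x\in\mathbb R^d: r_0<|x|<r_1\}$, and let $\tau\ge 0$. Let $f:A(r_0,r_1)\to\mathbb C$ be polyharmonic of infinite order and type $\tau$, i.e. $f$ is $C^\infty$ and for every compact $K\subset A(r_0,r_1)$ and every $\varepsilon>0$ there is $C_{K,\varepsilon}>0$ with $$\max_{x\in K}|\Delta^p f(x)|\le C_{K,\varepsilon}\,(2p)!\,(\tau+\varepsilon)^{2p}\qquad\text{for all } p\in\mathbb N_0 .$$ For each $k\in\mathbb N_0$ let $Y_{k,l}$, $l=1,\dots,a_k$, be a basis of the complex vector space of harmonic homogeneous polynomials of degree $k$ in $d$ variables that is orthonormal with respect to $\langle g,h\rangle=\int_{\mathbb S^{d-1}}g(\theta)\overline{h(\theta)}\,d\theta$, where $d\theta$ is the surface measure, and let $$f_{k,l}(r)=\int_{\mathbb S^{d-1}}f(r\theta)\overline{Y_{k,l}(\theta)}\,d\theta\quad(r_0<r<r_1),\qquad \tilde f_{k,l}(v)=f_{k,l}(e^v)\quad(\log r_0<v<\log r_1).$$ Put $\lambda_{2j}=k+2j$ and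 $\lambda_{2j+1}=-k-d+2+2j$ for $j\in\mathbb N_0$, let $$D^{(n)}g=\Big(\frac{d}{dv}-\lambda_0\Big)\cdots\Big(\frac{d}{dv}-\lambda_{n-1}\Big)g,\qquad \Phi_n(v)=\frac1{2\pi i}\oint\frac{e^{vz}}{(z-\lambda_0)\cdots(z-\lambda_n)}\,dz,$$ the integral being taken over a circle around $0$ that surrounds $\lambda_0,\dots,\lambda_n$. Then, for all $k\in\mathbb N_0$ and $l\in\{1,\dots,a_k\}$: (i) For every $v_0\in(\log r_0,\log r_1)$ the series $$\sum_{n=0}^\infty D^{(n)}\tilde f_{k,l}(v_0)\,\Phi_n(v-v_0)$$ converges absolutely, and uniformly on compact subsets, in the open disc in $\mathbb C$ with center $v_0$ and radius $\ln\big(1+\frac{1}{e^{v_0}\tau}\big)$ (understood as $\infty$ if $\tau=0$). Its sum is analytic in this disc and equals $\tilde f_{k,l}(v)$ for all real $v\in(\log r_0,\log r_1)$ that lie in the disc. (ii) If $\tau=0$, then $\tilde f_{k,l}$ is the restriction to $(\log r_0,\log r_1)$ of an entire function, and $f_{k,l}$ possesses an analytic extension from $(r_0,r_1)$ to $\mathbb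 C\setminus(-\infty,0]$. -/

import Mathlib

open scoped ContDiff

noncomputable section

namespace Polyharmonic

/-- The annular region `{x ∈ ℝ^d : r₀ < |x| < r₁}`; the outer radius may be `∞`. -/
def annulus (d : ℕ) (r₀ : ℝ) (r₁ : EReal) : Set (EuclideanSpace ℝ (Fin d)) :=
  {x | r₀ < ‖x‖ ∧ ((‖x‖ : ℝ) : EReal) < r₁}

/-- `f` is polyharmonic of infinite order and type `τ` on the open set `G`: it is smooth on `G`
and for every compact `K ⊆ G` and `ε > 0` there is `C > 0` such that
`|Δ^p f (x)| ≤ C (2p)! (τ + ε)^(2p)` for all `x ∈ K` and all `p`. -/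
def IsPolyharmonicOfType {d : ℕ} (G : Set (EuclideanSpace ℝ (Fin d))) (τ : ℝ)
    (f : EuclideanSpace ℝ (Fin d) → ℂ) : Prop :=
  ContDiffOn ℝ ∞ f G ∧
    ∀ K : Set (EuclideanSpace ℝ (Fin d)), K ⊆ G → IsCompact K → ∀ ε : ℝ, 0 < ε →
      ∃ C : ℝ, 0 < C ∧ ∀ p : ℕ, ∀ x ∈ K,
        ‖((Laplacian.laplacian : (EuclideanSpace ℝ (Fin d) → ℂ) →
            EuclideanSpace ℝ (Fin d) → ℂ)^[p] f) x‖ ≤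
          C * ((2 * p).factorial : ℝ) * (τ + ε) ^ (2 * p)

/-- The Laplace operator `∂²/∂x₁² + ⋯ + ∂²/∂x_d²` on polynomials. -/
def polyLaplacian (d : ℕ) : MvPolynomial (Fin d) ℂ →ₗ[ℂ] MvPolynomial (Fin d) ℂ :=
  ∑ i : Fin d, (MvPolynomial.pderiv (R := ℂ) i).toLinearMap ∘ₗ
    (MvPolynomial.pderiv (R := ℂ) i).toLinearMap

/-- The complex vector space of harmonic homogeneous polynomials of degree `k` in `d` variables. -/
def harmonicHomogeneous (d k : ℕ) : Submodule ℂ (MvPolynomial (Fin d) ℂ) :=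
  MvPolynomial.homogeneousSubmodule (Fin d) ℂ k ⊓ LinearMap.ker (polyLaplacian d)

/-- The dimension `a_k` of the space of harmonic homogeneous polynomials of degree `k`. -/
def harmonicDim (d k : ℕ) : ℕ := Module.finrank ℂ (harmonicHomogeneous d k)

/-- The value of a complex polynomial at a point of `ℝ^d`. -/
def evalReal {d : ℕ} (P : MvPolynomial (Fin d) ℂ) (x : EuclideanSpace ℝ (Fin d)) : ℂ :=
  MvPolynomial.eval (fun i => ((x i : ℝ) : ℂ)) P

/-- The scalar product `∫ P(θ) conj(Q(θ)) dθ` over the unit sphere with its surface measure. -/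
def sphereInner {d : ℕ} (P Q : MvPolynomial (Fin d) ℂ) : ℂ :=
  ∫ θ : Metric.sphere (0 : EuclideanSpace ℝ (Fin d)) 1,
    evalReal P θ * (starRingEnd ℂ) (evalReal Q θ) ∂(MeasureTheory.volume.toSphere)

/-- The Fourier-Laplace coefficient `r ↦ ∫ f(rθ) conj(Y(θ)) dθ` of `f` with respect to `Y`. -/
def fourierLaplaceCoeff {d : ℕ} (f : EuclideanSpace ℝ (Fin d) → ℂ) (Y : MvPolynomial (Fin d) ℂ)
    (r : ℝ) : ℂ :=
  ∫ θ : Metric.sphere (0 : EuclideanSpace ℝ (Fin d)) 1,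
    f (r • (θ : EuclideanSpace ℝ (Fin d))) * (starRingEnd ℂ) (evalReal Y θ)
      ∂(MeasureTheory.volume.toSphere)

/-- The exponents `λ_{2j} = k + 2j` and `λ_{2j+1} = -k - d + 2 + 2j`. -/
def exponent (d k n : ℕ) : ℂ :=
  if Even n then (k : ℂ) + 2 * ((n / 2 : ℕ) : ℂ)
  else -(k : ℂ) - (d : ℂ) + 2 + 2 * ((n / 2 : ℕ) : ℂ)

/-- `D^(n) g = (d/dv - λ₀) ⋯ (d/dv - λ_{n-1}) g`; the order of the factors is immaterial for
smooth `g`. -/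
def genDeriv (lam : ℕ → ℂ) : ℕ → (ℝ → ℂ) → ℝ → ℂ
  | 0, g => g
  | n + 1, g => fun v => deriv (genDeriv lam n g) v - lam n * genDeriv lam n g v

/-- The fundamental function of `(d/dx - λ₀) ⋯ (d/dx - λ_n)`,
`Φ_n(x) = (1 / 2πi) ∮ e^{xz} / ((z - λ₀) ⋯ (z - λ_n)) dz`, where the integral is over a circle
around `0` that surrounds `λ₀, …, λ_n`. -/
def fundamentalFunction (lam : ℕ → ℂ) (n : ℕ) (x : ℂ) : ℂ :=
  (2 * (Real.pi : ℂ) * Complex.I)⁻¹ *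
    ∮ z in C(0, 1 + ∑ j ∈ Finset.range (n + 1), ‖lam j‖),
      Complex.exp (x * z) / ∏ j ∈ Finset.range (n + 1), (z - lam j)

/-- The `n`-th term `D^(n) g(v₀) Φ_n(z - v₀)` of the generalized Taylor series of `g` at `v₀`. -/
def taylorTerm (lam : ℕ → ℂ) (g : ℝ → ℂ) (v₀ : ℝ) (n : ℕ) (z : ℂ) : ℂ :=
  genDeriv lam n g v₀ * fundamentalFunction lam n (z - (v₀ : ℂ))

/-- The open disc in `ℂ` with center `v₀` and radius `ln (1 + 1 / (e^{v₀} τ))`, where the radius is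
`∞` for `τ = 0`. -/
def convergenceDisc (τ v₀ : ℝ) : Set ℂ :=
  if τ = 0 then Set.univ
  else Metric.ball (v₀ : ℂ) (Real.log (1 + 1 / (Real.exp v₀ * τ)))

end Polyharmonic

end

open scoped ContDiff

noncomputable section

namespace Polyharmonic

/-! In the variable `v = log r`, the radial derivative `r ∂_r` becomes `d/dv`. Up to the factor
`e^{2v}`, the Laplacian acts on the coefficient against a harmonic polynomial of degree `k` as
`(d/dv - k)(d/dv + k + d - 2)`, which is `D^(2)`. Since `e^{2pv}` shifts exponents by `2p`,
iteration shows that `D^(2p)` of the coefficient of `f` is `e^{2pv}` times the coefficient of `Δ^p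
f` (`genDeriv_even_eqOn`). The type condition therefore bounds the even generalized derivatives by
`C n! (e^v ρ)^n` for every `ρ > τ`. Odd orders follow by interpolating between the two neighbouring
even ones (`exists_bound_genDeriv`).

On the other side, `|λ_j| ≤ b + j` gives `|Φ_n(z)| ≤ e^{b|z|} (e^{|z|} - 1)^n / n!`
(`norm_fundamentalFunction_le`). The factorials cancel and the series is dominated by a geometric
one of ratio `e^{v₀} ρ (e^{|z - v₀|} - 1)`. With `τ` for `ρ`, this ratio is below `1` exactly in the
stated disc. The Taylor remainder obeys the same geometric rate up to a factor linear in `N`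
(`tsum_taylorTerm_eq`), so the sum is the function itself. For `τ = 0` a single disc is the whole
plane, and composition with the principal logarithm gives the extension to the slit plane.

The radial form of the Laplacian is obtained without polar coordinates: the spherical part is half
the sum of squares of the rotation fields, and these are integrated by parts using rotation
invariance of the surface measure (`exp_mul_sphereCoeff_laplacian`). -/

/-- Differentiation of a Laplace-type circle integral with respect to the parameter. -/
lemma hasDerivAt_circleIntegral_exp_mul {R : ℝ} {φ : ℂ → ℂ} (hR : 0 ≤ R)
    (hφ : ContinuousOn φ (Metric.sphere 0 R)) (x : ℂ) :
    HasDerivAt (fun x => ∮ z in C(0, R), Complex.exp (x * z) * φ z)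
      (∮ z in C(0, R), z * Complex.exp (x * z) * φ z) x := by
  have hc : Continuous (circleMap 0 R) := continuous_circleMap 0 R
  have hd : Continuous (deriv (circleMap 0 R)) := by
    have : deriv (circleMap 0 R) = fun t => circleMap 0 R t * Complex.I := by
      ext t; simp
    rw [this]; fun_prop
  have hp : Continuous (fun t => φ (circleMap 0 R t)) :=
    hφ.comp_continuous hc fun t => circleMap_mem_sphere 0 hR t
  have hF' : Continuous fun p : ℂ × ℝ => deriv (circleMap 0 R) p.2 *
      (circleMap 0 R p.2 * Complex.exp (p.1 * circleMap 0 R p.2) * φ (circleMap 0 R p.2)) := by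
    have h1 := hd.comp (continuous_snd (X := ℂ) (Y := ℝ))
    have h2 := hp.comp (continuous_snd (X := ℂ) (Y := ℝ))
    have h3 := hc.comp (continuous_snd (X := ℂ) (Y := ℝ))
    exact h1.mul ((h3.mul (Complex.continuous_exp.comp (continuous_fst.mul h3))).mul h2)
  obtain ⟨M, hM⟩ := ((isCompact_closedBall x 1).prod
    (isCompact_Icc (a := (0 : ℝ)) (b := 2 * Real.pi))).exists_bound_of_continuousOn hF'.continuousOn
  have hpi : (0 : ℝ) ≤ 2 * Real.pi := Real.two_pi_pos.le
  refine (intervalIntegral.hasDerivAt_integral_of_dominated_loc_of_deriv_le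
    (μ := MeasureTheory.volume) (a := 0) (b := 2 * Real.pi) (bound := fun _ => M)
    (F := fun x t => deriv (circleMap 0 R) t *
      (Complex.exp (x * circleMap 0 R t) * φ (circleMap 0 R t)))
    (F' := fun x t => deriv (circleMap 0 R) t *
      (circleMap 0 R t * Complex.exp (x * circleMap 0 R t) * φ (circleMap 0 R t)))
    (Metric.closedBall_mem_nhds x one_pos) ?_ ?_ ?_ ?_ ?_ ?_).2
  · refine Filter.Eventually.of_forall fun y => Continuous.aestronglyMeasurable ?_
    exact hd.mul ((Complex.continuous_exp.comp (continuous_const.mul hc)).mul hp)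
  · refine Continuous.intervalIntegrable ?_ _ _
    exact hd.mul ((Complex.continuous_exp.comp (continuous_const.mul hc)).mul hp)
  · refine Continuous.aestronglyMeasurable ?_
    exact hd.mul ((hc.mul (Complex.continuous_exp.comp (continuous_const.mul hc))).mul hp)
  · refine Filter.Eventually.of_forall fun t ht y hy => hM (y, t) ⟨hy, ?_⟩
    rw [Set.uIoc_of_le hpi] at ht
    exact ⟨ht.1.le, ht.2⟩
  · exact intervalIntegrable_const
  · refine Filter.Eventually.of_forall fun t _ y _ => ?_
    have h : HasDerivAt (fun y : ℂ => Complex.exp (y * circleMap 0 R t))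
        (Complex.exp (y * circleMap 0 R t) * (1 * circleMap 0 R t)) y :=
      ((hasDerivAt_id y).mul_const _).cexp
    refine ((h.mul_const (φ (circleMap 0 R t))).const_mul
      (deriv (circleMap 0 R) t)).congr_deriv ?_
    ring

/-! ### Fundamental functions: differential recursion and growth. -/

section FundamentalFunction

variable (lam : ℕ → ℂ)

/-- The radius of the contour in the definition of the fundamental function. -/
def contourRadius (n : ℕ) : ℝ := 1 + ∑ j ∈ Finset.range (n + 1), ‖lam j‖

lemma contourRadius_pos (n : ℕ) : 0 < contourRadius lam n := by
  have : 0 ≤ ∑ j ∈ Finset.range (n + 1), ‖lam j‖ := Finset.sum_nonneg fun _ _ => norm_nonneg _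
  unfold contourRadius; linarith

lemma norm_add_one_le_contourRadius {n j : ℕ} (hj : j ∈ Finset.range (n + 1)) :
    ‖lam j‖ + 1 ≤ contourRadius lam n := by
  have := Finset.single_le_sum (f := fun j => ‖lam j‖) (fun _ _ => norm_nonneg _) hj
  unfold contourRadius; linarith

lemma contourRadius_le_succ (n : ℕ) : contourRadius lam n ≤ contourRadius lam (n + 1) := by
  unfold contourRadius
  rw [Finset.sum_range_succ _ (n + 1)]
  linarith [norm_nonneg (lam (n + 1))]

lemma prod_sub_ne_zero {n : ℕ} {z : ℂ} (hz : contourRadius lam n ≤ ‖z‖) :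
    ∏ j ∈ Finset.range (n + 1), (z - lam j) ≠ 0 := by
  refine Finset.prod_ne_zero_iff.2 fun j hj h => ?_
  have := norm_add_one_le_contourRadius lam hj
  rw [sub_eq_zero.1 h] at hz
  linarith

/-- All poles lie inside the smaller circle, so the contour may be enlarged freely. This lets
consecutive orders share one contour and allows the radius to tend to infinity. -/
lemma circleIntegral_div_prod_eq {n : ℕ} {g : ℂ → ℂ} (hg : Differentiable ℂ g) {R : ℝ}
    (hR : contourRadius lam n ≤ R) :
    ∮ z in C(0, R), g z / ∏ j ∈ Finset.range (n + 1), (z - lam j) =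
      ∮ z in C(0, contourRadius lam n), g z / ∏ j ∈ Finset.range (n + 1), (z - lam j) := by
  have hP : Differentiable ℂ fun z : ℂ => ∏ j ∈ Finset.range (n + 1), (z - lam j) := by
    fun_prop
  refine Complex.circleIntegral_eq_of_differentiable_on_annulus_off_countable
    (contourRadius_pos lam n) hR Set.countable_empty ?_ ?_
  · refine hg.continuous.continuousOn.div hP.continuous.continuousOn fun z hz => ?_
    exact prod_sub_ne_zero lam (by simpa using hz.2)
  · rintro z ⟨⟨_, hz⟩, _⟩
    refine (hg z).div (hP z) (prod_sub_ne_zero lam ?_)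
    have : contourRadius lam n < ‖z‖ := by simpa using hz
    exact this.le

lemma fundamentalFunction_eq {n : ℕ} {R : ℝ} (hR : contourRadius lam n ≤ R) (x : ℂ) :
    fundamentalFunction lam n x = (2 * (Real.pi : ℂ) * Complex.I)⁻¹ *
      ∮ z in C(0, R), Complex.exp (x * z) / ∏ j ∈ Finset.range (n + 1), (z - lam j) := by
  rw [circleIntegral_div_prod_eq lam (by fun_prop) hR]
  rfl

lemma fundamentalFunction_zero (x : ℂ) :
    fundamentalFunction lam 0 x = Complex.exp (lam 0 * x) := by
  have h := Complex.circleIntegral_div_sub_of_differentiable_on_off_countable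
    (R := contourRadius lam 0) (c := 0) (w := lam 0) (f := fun z => Complex.exp (x * z))
    Set.countable_empty (by
      have := norm_add_one_le_contourRadius lam (n := 0) (j := 0) (by simp)
      simp only [Metric.mem_ball, dist_zero_right]; linarith)
    (Continuous.continuousOn (by fun_prop)) (fun z _ => by fun_prop)
  rw [fundamentalFunction_eq lam le_rfl]
  simp only [zero_add, Finset.range_one, Finset.prod_singleton]
  rw [h, ← mul_assoc, inv_mul_cancel₀ Complex.two_pi_I_ne_zero, one_mul, mul_comm]

/-- At `x = 0` the integrand is `O(R^{-(n+2)})` on a circle of length `2πR`, so letting `R → ∞`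
gives zero. -/
lemma fundamentalFunction_succ_apply_zero (n : ℕ) : fundamentalFunction lam (n + 1) 0 = 0 := by
  set r := contourRadius lam (n + 1) with hr
  have hrpos : 0 < r := contourRadius_pos lam _
  have key : ∀ R : ℝ, 2 * r ≤ R → ‖fundamentalFunction lam (n + 1) 0‖ ≤
      ‖(2 * (Real.pi : ℂ) * Complex.I)⁻¹‖ *
        (2 * Real.pi * R * ((R / 2) ^ (n + 2))⁻¹) := by
    intro R hR
    rw [fundamentalFunction_eq lam (show contourRadius lam (n + 1) ≤ R by linarith), norm_mul]
    gcongr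
    -- Since `|λ_j| ≤ r ≤ R / 2`, each factor satisfies `|z - λ_j| ≥ R / 2`.
    refine circleIntegral.norm_integral_le_of_norm_le_const (by linarith) fun z hz => ?_
    have hz' : ‖z‖ = R := by simpa using hz
    rw [zero_mul, Complex.exp_zero, norm_div, norm_one, one_div, norm_prod]
    refine inv_anti₀ (pow_pos (by linarith) _) ?_
    calc (R / 2) ^ (n + 2) = ∏ j ∈ Finset.range (n + 1 + 1), (R / 2) := by
          rw [Finset.prod_const, Finset.card_range]
      _ ≤ _ := by
        refine Finset.prod_le_prod (fun _ _ => by linarith) fun j hj => ?_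
        have h1 := norm_add_one_le_contourRadius lam hj
        have h2 := norm_sub_norm_le z (lam j)
        linarith
  have hlim : Filter.Tendsto (fun R : ℝ => ‖(2 * (Real.pi : ℂ) * Complex.I)⁻¹‖ *
        (2 * Real.pi * R * ((R / 2) ^ (n + 2))⁻¹)) Filter.atTop (nhds 0) := by
    have h1 : Filter.Tendsto (fun R : ℝ => ((R / 2) ^ (n + 1))⁻¹) Filter.atTop (nhds 0) :=
      ((Filter.tendsto_pow_atTop (by omega)).comp
        (Filter.tendsto_id.atTop_div_const two_pos)).inv_tendsto_atTop
    have h2 := (h1.const_mul (4 * Real.pi)).const_mul ‖(2 * (Real.pi : ℂ) * Complex.I)⁻¹‖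
    rw [mul_zero, mul_zero] at h2
    refine h2.congr' ?_
    filter_upwards [Filter.eventually_gt_atTop (0 : ℝ)] with R hR
    congr 1
    rw [pow_succ _ (n + 1)]
    field_simp
    ring
  have := ge_of_tendsto hlim ((Filter.eventually_ge_atTop (2 * r)).mono key)
  exact norm_le_zero_iff.1 this

/-- Differentiation inserts a factor `z = λ_{n+1} + (z - λ_{n+1})` under the integral; the second
summand cancels the last factor of the denominator. -/
lemma hasDerivAt_fundamentalFunction_succ (n : ℕ) (x : ℂ) :
    HasDerivAt (fundamentalFunction lam (n + 1))
      (lam (n + 1) * fundamentalFunction lam (n + 1) x + fundamentalFunction lam n x) x := by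
  set r := contourRadius lam (n + 1) with hr
  have hrpos : 0 < r := contourRadius_pos lam _
  have hP : Continuous fun z : ℂ => ∏ j ∈ Finset.range (n + 1 + 1), (z - lam j) := by fun_prop
  have hP' : Continuous fun z : ℂ => ∏ j ∈ Finset.range (n + 1), (z - lam j) := by fun_prop
  have hne : ∀ z ∈ Metric.sphere (0 : ℂ) r,
      ∏ j ∈ Finset.range (n + 1 + 1), (z - lam j) ≠ 0 := fun z hz =>
    prod_sub_ne_zero lam (by simpa using hz.ge)
  have hne' : ∀ z ∈ Metric.sphere (0 : ℂ) r,
      ∏ j ∈ Finset.range (n + 1), (z - lam j) ≠ 0 := fun z hz =>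
    prod_sub_ne_zero lam ((contourRadius_le_succ lam n).trans (by simpa using hz.ge))
  have h := (hasDerivAt_circleIntegral_exp_mul (R := r) hrpos.le
    (hP.continuousOn.inv₀ hne) x).const_mul ((2 * (Real.pi : ℂ) * Complex.I)⁻¹)
  rw [fundamentalFunction_eq lam (contourRadius_le_succ lam n) x,
    fundamentalFunction_eq lam (n := n + 1) le_rfl x]
  have hfun : fundamentalFunction lam (n + 1) = fun x => (2 * (Real.pi : ℂ) * Complex.I)⁻¹ *
      ∮ z in C(0, r), Complex.exp (x * z) * (∏ j ∈ Finset.range (n + 1 + 1), (z - lam j))⁻¹ := by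
    ext y
    rw [fundamentalFunction_eq lam (n := n + 1) le_rfl y]
    simp only [div_eq_mul_inv, hr]
  rw [hfun]
  refine h.congr_deriv ?_
  symm
  rw [mul_left_comm, ← mul_add, ← circleIntegral.integral_const_mul, ← circleIntegral.integral_add]
  · congr 1
    refine circleIntegral.integral_congr hrpos.le fun z hz => ?_
    have h1 := hne z hz
    have h2 := hne' z hz
    rw [Finset.prod_range_succ] at h1
    have h3 : z - lam (n + 1) ≠ 0 := right_ne_zero_of_mul h1
    simp only [Finset.prod_range_succ _ (n + 1), Pi.inv_apply]
    field_simp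
    ring
  · refine ContinuousOn.circleIntegrable hrpos.le (continuousOn_const.mul ?_)
    exact (Continuous.continuousOn (by fun_prop)).div hP.continuousOn hne
  · refine ContinuousOn.circleIntegrable hrpos.le ?_
    exact (Continuous.continuousOn (by fun_prop)).div hP'.continuousOn hne'

lemma hasDerivAt_fundamentalFunction_zero (x : ℂ) :
    HasDerivAt (fundamentalFunction lam 0) (lam 0 * fundamentalFunction lam 0 x) x := by
  have h : fundamentalFunction lam 0 = fun x => Complex.exp (lam 0 * x) :=
    funext (fundamentalFunction_zero lam)
  rw [h]
  refine ((hasDerivAt_id x).const_mul (lam 0)).cexp.congr_deriv ?_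
  rw [mul_one, mul_comm]
  rfl

lemma differentiable_fundamentalFunction (n : ℕ) :
    Differentiable ℂ (fundamentalFunction lam n) := fun x => by
  cases n with
  | zero => exact (hasDerivAt_fundamentalFunction_zero lam x).differentiableAt
  | succ n => exact (hasDerivAt_fundamentalFunction_succ lam n x).differentiableAt

variable {lam}

/-- If `|λ_j| ≤ b + j`, then the fundamental functions are dominated by those of the
exponents `b, b + 1, …`, which are explicit. -/
lemma norm_fundamentalFunction_le {b : ℝ} (hb : ∀ j, ‖lam j‖ ≤ b + j) (n : ℕ) (z : ℂ) :
    ‖fundamentalFunction lam n z‖ ≤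
      Real.exp (b * ‖z‖) * (Real.exp ‖z‖ - 1) ^ n / n.factorial := by
  induction n generalizing z with
  | zero =>
    rw [fundamentalFunction_zero, Complex.norm_exp]
    simp only [pow_zero, mul_one, Nat.factorial_zero, Nat.cast_one, div_one]
    refine Real.exp_le_exp.2 ((Complex.re_le_norm _).trans ?_)
    rw [norm_mul]
    have := hb 0
    simp only [Nat.cast_zero, add_zero] at this
    gcongr
  | succ n ih =>
    set R := ‖z‖ with hR
    set m := lam (n + 1) with hm
    have hm' : ‖m‖ ≤ b + (n + 1) := by simpa using hb (n + 1)
    -- The integrating factor removes the `λ_{n+1}` term: this curve runs from `0` at `t = 0` to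
    -- `Φ_{n+1}(z)` at `t = 1`, and its derivative involves only `Φ_n`.
    have hf : ∀ t : ℝ, HasDerivAt
        (fun t : ℝ => Complex.exp (m * z * (1 - t)) * fundamentalFunction lam (n + 1) (t * z))
        (z * Complex.exp (m * z * (1 - t)) * fundamentalFunction lam n (t * z)) t := by
      intro t
      have h1 : HasDerivAt (fun t : ℂ => Complex.exp (m * z * (1 - t)))
          (Complex.exp (m * z * (1 - t)) * (m * z * (-1))) t :=
        (((hasDerivAt_id (t : ℂ)).const_sub 1).const_mul (m * z)).cexp
      have h2 : HasDerivAt (fun t : ℂ => fundamentalFunction lam (n + 1) (t * z))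
          ((m * fundamentalFunction lam (n + 1) (t * z) + fundamentalFunction lam n (t * z)) *
            (1 * z)) t :=
        HasDerivAt.comp (h₂ := fundamentalFunction lam (n + 1)) (h := fun t : ℂ => t * z) (t : ℂ)
          (hasDerivAt_fundamentalFunction_succ lam n (t * z))
          ((hasDerivAt_id (t : ℂ)).mul_const z)
      refine (h1.mul h2).comp_ofReal.congr_deriv ?_
      ring
    -- The majorant satisfies the same equation exactly, with `b + (n + 1)` and `|z|` in place of
    -- `λ_{n+1}` and `z`. Both curves start at `0`, so comparing derivatives suffices.
    have hB : ∀ t : ℝ, HasDerivAt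
        (fun t : ℝ => Real.exp ((b + (n + 1)) * R * (1 - t)) *
          (Real.exp (b * (t * R)) * (Real.exp (t * R) - 1) ^ (n + 1) / (n + 1).factorial))
        (R * Real.exp ((b + (n + 1)) * R * (1 - t)) *
          (Real.exp (b * (t * R)) * (Real.exp (t * R) - 1) ^ n / n.factorial)) t := by
      intro t
      have h1 : HasDerivAt (fun t : ℝ => Real.exp ((b + (n + 1)) * R * (1 - t)))
          (Real.exp ((b + (n + 1)) * R * (1 - t)) * ((b + (n + 1)) * R * (-1))) t :=
        (((hasDerivAt_id t).const_sub 1).const_mul ((b + (n + 1)) * R)).exp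
      have h0 : HasDerivAt (fun t : ℝ => t * R) (1 * R) t := (hasDerivAt_id t).mul_const R
      have h2 := (h0.const_mul b).exp
      have h3 := (h0.exp.sub_const 1).pow (n + 1)
      refine (h1.mul ((h2.mul h3).div_const ((n + 1).factorial : ℝ))).congr_deriv ?_
      have hfac : ((n + 1).factorial : ℝ) = (n + 1) * n.factorial := by
        rw [Nat.factorial_succ]; push_cast; ring
      have hfac0 : (n.factorial : ℝ) ≠ 0 := by positivity
      have hn0 : (n : ℝ) + 1 ≠ 0 := by positivity
      rw [hfac]
      simp only [Pi.pow_apply, Nat.add_sub_cancel, Pi.mul_apply]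
      push_cast
      rw [pow_succ]
      field_simp
      ring
    have main := image_norm_le_of_norm_deriv_right_le_deriv_boundary (a := 0) (b := 1)
      (fun t _ => (hf t).continuousAt.continuousWithinAt)
      (fun t _ => (hf t).hasDerivWithinAt) (by
        simp [fundamentalFunction_succ_apply_zero]) hB (fun t ht => by
        have ht0 : 0 ≤ t := ht.1
        have ht1 : 0 ≤ 1 - t := by linarith [ht.2]
        have htz : ‖(t : ℂ) * z‖ = t * R := by
          rw [norm_mul, Complex.norm_real, Real.norm_of_nonneg ht0]
        have := ih (t * z)
        rw [htz] at this
        rw [norm_mul, norm_mul]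
        have hexp : ‖Complex.exp (m * z * (1 - t))‖ ≤
            Real.exp ((b + (n + 1)) * R * (1 - t)) := by
          rw [Complex.norm_exp]
          refine Real.exp_le_exp.2 ((Complex.re_le_norm _).trans ?_)
          rw [norm_mul, norm_mul]
          have : ‖(1 : ℂ) - t‖ = 1 - t := by
            rw [← Complex.ofReal_one, ← Complex.ofReal_sub, Complex.norm_real,
              Real.norm_of_nonneg ht1]
          rw [this]
          gcongr
        gcongr)
      (Set.right_mem_Icc.2 zero_le_one)
    simpa using main

end FundamentalFunction

/-! ### Generalized Taylor polynomials and their remainder. -/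

section GeneralizedTaylor

variable {lam : ℕ → ℂ} {g : ℝ → ℂ}

lemma hasDerivAt_genDeriv {n : ℕ} {s : ℝ} (h : DifferentiableAt ℝ (genDeriv lam n g) s) :
    HasDerivAt (genDeriv lam n g) (genDeriv lam (n + 1) g s + lam n * genDeriv lam n g s) s := by
  refine h.hasDerivAt.congr_deriv ?_
  simp [genDeriv]

lemma hasDerivAt_comp_const_sub {Φ : ℂ → ℂ} {Φ' : ℂ} {v s : ℝ}
    (h : HasDerivAt Φ Φ' ((v : ℂ) - s)) :
    HasDerivAt (fun s : ℝ => Φ ((v : ℂ) - s)) (-Φ') s := by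
  have h1 : HasDerivAt (fun s : ℂ => (v : ℂ) - s) (-1) (s : ℂ) :=
    (hasDerivAt_id (s : ℂ)).const_sub (v : ℂ)
  refine (HasDerivAt.comp (h₂ := Φ) (h := fun s : ℂ => (v : ℂ) - s) (s : ℂ) h
    h1).comp_ofReal.congr_deriv ?_
  ring

/-- The derivative of a generalized Taylor polynomial with respect to its center telescopes. -/
lemma hasDerivAt_sum_genDeriv_mul (v : ℝ) (N : ℕ) {s : ℝ}
    (hg : ∀ n ≤ N, DifferentiableAt ℝ (genDeriv lam n g) s) :
    HasDerivAt (fun s : ℝ => ∑ n ∈ Finset.range (N + 1),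
        genDeriv lam n g s * fundamentalFunction lam n ((v : ℂ) - s))
      (genDeriv lam (N + 1) g s * fundamentalFunction lam N ((v : ℂ) - s)) s := by
  induction N with
  | zero =>
    simp only [zero_add, Finset.range_one, Finset.sum_singleton]
    refine ((hasDerivAt_genDeriv (hg 0 le_rfl)).mul
      (hasDerivAt_comp_const_sub (hasDerivAt_fundamentalFunction_zero lam _))).congr_deriv ?_
    ring
  | succ N ih =>
    simp only [Finset.sum_range_succ _ (N + 1)]
    -- The `λ_{N+1}` contributions of the two factors cancel, and the term with `Φ_N` cancels the
    -- derivative of the shorter sum.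
    refine ((ih fun n hn => hg n (hn.trans N.le_succ)).add
      ((hasDerivAt_genDeriv (hg (N + 1) le_rfl)).mul
      (hasDerivAt_comp_const_sub (hasDerivAt_fundamentalFunction_succ lam N _)))).congr_deriv ?_
    ring

lemma sum_genDeriv_mul_fundamentalFunction_self (N : ℕ) (v : ℝ) :
    ∑ n ∈ Finset.range (N + 1), genDeriv lam n g v * fundamentalFunction lam n ((v : ℂ) - v) =
      g v := by
  rw [Finset.sum_range_succ', sub_self]
  simp [fundamentalFunction_succ_apply_zero, fundamentalFunction_zero, genDeriv]

/-- The remainder estimate for the generalized Taylor expansion. -/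
lemma norm_sub_sum_genDeriv_mul_le {s v C : ℝ} {N : ℕ}
    (hg : ∀ n ≤ N, ∀ t ∈ Set.uIcc s v, DifferentiableAt ℝ (genDeriv lam n g) t)
    (hC : ∀ t ∈ Set.uIcc s v,
      ‖genDeriv lam (N + 1) g t * fundamentalFunction lam N ((v : ℂ) - t)‖ ≤ C) :
    ‖g v - ∑ n ∈ Finset.range (N + 1),
      genDeriv lam n g s * fundamentalFunction lam n ((v : ℂ) - s)‖ ≤ C * |v - s| := by
  -- Mean value inequality in the center of the expansion: with center `v` the polynomial takes the
  -- value `g v` at `v`, with center `s` it is the approximation.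
  have := Convex.norm_image_sub_le_of_norm_hasDerivWithin_le (s := Set.uIcc s v) (x := s) (y := v)
    (fun t ht => (hasDerivAt_sum_genDeriv_mul v N fun n hn => hg n hn t ht).hasDerivWithinAt)
    hC (convex_uIcc s v) Set.left_mem_uIcc Set.right_mem_uIcc
  rwa [sum_genDeriv_mul_fundamentalFunction_self] at this

end GeneralizedTaylor

/-! ### Convergence of the generalized Taylor series. -/

section Convergence

variable {lam : ℕ → ℂ} {g : ℝ → ℂ} {v₀ τ : ℝ}

/-- The logarithm-free form treats `τ = 0` and `τ > 0` alike and displays the limiting ratio of the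
dominating geometric series. -/
lemma mem_convergenceDisc_iff (hτ : 0 ≤ τ) (z : ℂ) :
    z ∈ convergenceDisc τ v₀ ↔ Real.exp v₀ * τ * (Real.exp ‖z - v₀‖ - 1) < 1 := by
  unfold convergenceDisc
  split_ifs with h
  · simp [h]
  · have hpos : 0 < Real.exp v₀ * τ := mul_pos (Real.exp_pos _) (lt_of_le_of_ne hτ (Ne.symm h))
    rw [Metric.mem_ball, dist_eq_norm, Real.lt_log_iff_exp_lt (by positivity),
      ← sub_lt_iff_lt_add', lt_div_iff₀ hpos, mul_comm]

lemma isOpen_convergenceDisc (τ v₀ : ℝ) : IsOpen (convergenceDisc τ v₀) := by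
  unfold convergenceDisc
  split_ifs
  · exact isOpen_univ
  · exact Metric.isOpen_ball

lemma norm_taylorTerm_le {b C ρ R : ℝ} (hb : ∀ j, ‖lam j‖ ≤ b + j) (hb0 : 0 ≤ b) (hC : 0 ≤ C)
    (hρ : 0 ≤ ρ)
    (hD : ∀ n, ‖genDeriv lam n g v₀‖ ≤ C * n.factorial * (Real.exp v₀ * ρ) ^ n) (n : ℕ)
    {z : ℂ} (hz : ‖z - v₀‖ ≤ R) :
    ‖taylorTerm lam g v₀ n z‖ ≤
      C * Real.exp (b * R) * (Real.exp v₀ * ρ * (Real.exp R - 1)) ^ n := by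
  have hR : 0 ≤ R := (norm_nonneg _).trans hz
  have h1 : 0 ≤ Real.exp ‖z - v₀‖ - 1 := by
    linarith [Real.add_one_le_exp ‖z - v₀‖, norm_nonneg (z - v₀)]
  unfold taylorTerm
  rw [norm_mul]
  calc _ ≤ (C * n.factorial * (Real.exp v₀ * ρ) ^ n) *
        (Real.exp (b * R) * (Real.exp R - 1) ^ n / n.factorial) := by
        gcongr
        · exact hD n
        · refine (norm_fundamentalFunction_le hb n _).trans ?_
          gcongr
    _ = _ := by
        rw [mul_pow _ (Real.exp R - 1)]
        have : (n.factorial : ℝ) ≠ 0 := by positivity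
        field_simp

/-- A rate `ρ > τ` for which the comparison series at radius `R` converges. -/
lemma exists_rate {A B : ℝ} (h : A * τ * B < 1) :
    ∃ ρ > τ, A * ρ * B < 1 := by
  have hc : Filter.Tendsto (fun ρ : ℝ => A * ρ * B) (nhdsWithin τ (Set.Ioi τ))
      (nhds (A * τ * B)) :=
    (Continuous.tendsto (by fun_prop) τ).mono_left nhdsWithin_le_nhds
  obtain ⟨ρ, h1, h2⟩ := ((hc.eventually_lt_const h).and self_mem_nhdsWithin).exists
  exact ⟨ρ, h2, h1⟩

/-- A function whose generalized derivatives at `v₀` grow at most like `n! (e^{v₀} ρ)^n` for all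
`ρ > τ` has a dominated generalized Taylor series on all closed discs in the convergence disc. -/
lemma exists_summable_bound {b : ℝ} (hb : ∀ j, ‖lam j‖ ≤ b + j) (hb0 : 0 ≤ b) (hτ : 0 ≤ τ)
    (hD : ∀ ρ > τ, ∃ C ≥ 0, ∀ n,
      ‖genDeriv lam n g v₀‖ ≤ C * n.factorial * (Real.exp v₀ * ρ) ^ n)
    {R : ℝ} (hR0 : 0 ≤ R) (hR : Real.exp v₀ * τ * (Real.exp R - 1) < 1) :
    ∃ u : ℕ → ℝ, Summable u ∧ ∀ n (z : ℂ), ‖z - v₀‖ ≤ R → ‖taylorTerm lam g v₀ n z‖ ≤ u n := by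
  have h1 : 0 ≤ Real.exp R - 1 := by linarith [Real.add_one_le_exp R]
  obtain ⟨ρ, hρ, hlt⟩ := exists_rate hR
  obtain ⟨C, hC, hDC⟩ := hD ρ hρ
  have hρ0 : 0 ≤ ρ := hτ.trans hρ.le
  refine ⟨_, ?_, fun n z hz => norm_taylorTerm_le hb hb0 hC hρ0 hDC n hz⟩
  exact (summable_geometric_of_lt_one (by positivity) hlt).mul_left _

variable {b : ℝ} (hb : ∀ j, ‖lam j‖ ≤ b + j) (hb0 : 0 ≤ b) (hτ : 0 ≤ τ)
  (hD : ∀ ρ > τ, ∃ C ≥ 0, ∀ n,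
      ‖genDeriv lam n g v₀‖ ≤ C * n.factorial * (Real.exp v₀ * ρ) ^ n)

include hb hb0 hτ hD

lemma summable_norm_taylorTerm {z : ℂ} (hz : z ∈ convergenceDisc τ v₀) :
    Summable fun n => ‖taylorTerm lam g v₀ n z‖ := by
  obtain ⟨u, hu, h⟩ := exists_summable_bound hb hb0 hτ hD (norm_nonneg _)
    ((mem_convergenceDisc_iff hτ z).1 hz)
  exact Summable.of_nonneg_of_le (fun _ => norm_nonneg _) (fun n => h n z le_rfl) hu

lemma tendstoUniformlyOn_taylorSeries {K : Set ℂ} (hK : K ⊆ convergenceDisc τ v₀)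
    (hKc : IsCompact K) :
    TendstoUniformlyOn (fun (N : ℕ) (z : ℂ) => ∑ n ∈ Finset.range N, taylorTerm lam g v₀ n z)
      (fun z => ∑' n, taylorTerm lam g v₀ n z) Filter.atTop K := by
  rcases K.eq_empty_or_nonempty with rfl | hne
  · exact tendstoUniformlyOn_empty
  obtain ⟨w, hw, hmax⟩ := hKc.exists_isMaxOn hne
    (f := fun z : ℂ => ‖z - v₀‖) (Continuous.continuousOn (by fun_prop))
  obtain ⟨u, hu, h⟩ := exists_summable_bound hb hb0 hτ hD (norm_nonneg _)
    ((mem_convergenceDisc_iff hτ w).1 (hK hw))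
  exact tendstoUniformlyOn_tsum_nat hu fun n z hz => h n z (hmax hz)

lemma analyticOnNhd_taylorSeries :
    AnalyticOnNhd ℂ (fun z => ∑' n, taylorTerm lam g v₀ n z) (convergenceDisc τ v₀) := by
  refine DifferentiableOn.analyticOnNhd ?_ (isOpen_convergenceDisc τ v₀)
  have hloc : TendstoLocallyUniformlyOn
      (fun (N : ℕ) (z : ℂ) => ∑ n ∈ Finset.range N, taylorTerm lam g v₀ n z)
      (fun z => ∑' n, taylorTerm lam g v₀ n z) Filter.atTop (convergenceDisc τ v₀) :=
    (tendstoLocallyUniformlyOn_iff_forall_isCompact (isOpen_convergenceDisc τ v₀)).2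
      fun K hK hKc => tendstoUniformlyOn_taylorSeries hb hb0 hτ hD hK hKc
  refine hloc.differentiableOn (Filter.Eventually.of_forall fun N => ?_)
    (isOpen_convergenceDisc τ v₀)
  refine DifferentiableOn.fun_sum fun n _ => Differentiable.differentiableOn ?_
  exact ((differentiable_fundamentalFunction lam n).comp
    (differentiable_id.sub_const (v₀ : ℂ))).const_mul _

omit hD in
/-- The generalized Taylor series converges to the function. -/
lemma tsum_taylorTerm_eq {v : ℝ} (hv : (v : ℂ) ∈ convergenceDisc τ v₀)
    (hg : ∀ n, ∀ t ∈ Set.uIcc v₀ v, DifferentiableAt ℝ (genDeriv lam n g) t)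
    (hD' : ∀ ρ > τ, ∃ C ≥ 0, ∀ n, ∀ t ∈ Set.uIcc v₀ v,
      ‖genDeriv lam n g t‖ ≤ C * n.factorial * (Real.exp t * ρ) ^ n) :
    ∑' n, taylorTerm lam g v₀ n v = g v := by
  have hD : ∀ ρ > τ, ∃ C ≥ 0, ∀ n,
      ‖genDeriv lam n g v₀‖ ≤ C * n.factorial * (Real.exp v₀ * ρ) ^ n := fun ρ hρ => by
    obtain ⟨C, hC, h⟩ := hD' ρ hρ
    exact ⟨C, hC, fun n => h n v₀ Set.left_mem_uIcc⟩
  have hsum := (summable_norm_taylorTerm hb hb0 hτ hD hv).of_norm.hasSum.tendsto_sum_nat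
  -- The shift by one matches the `N + 1` terms in the remainder estimate.
  refine tendsto_nhds_unique hsum ((Filter.tendsto_add_atTop_iff_nat 1).1 ?_)
  set L := |v - v₀| with hL
  have hnorm : ‖(v : ℂ) - v₀‖ = L := by
    rw [← Complex.ofReal_sub, Complex.norm_real, Real.norm_eq_abs]
  have hlt := (mem_convergenceDisc_iff hτ _).1 hv
  rw [hnorm] at hlt
  have h1 : 0 ≤ Real.exp L - 1 := by linarith [Real.add_one_le_exp L, abs_nonneg (v - v₀)]
  obtain ⟨ρ, hρ, hq1⟩ := exists_rate hlt
  have hρ0 : 0 ≤ ρ := hτ.trans hρ.le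
  set q := Real.exp v₀ * ρ * (Real.exp L - 1) with hq
  have hq0 : 0 ≤ q := by positivity
  obtain ⟨C, hC, hCb⟩ := hD' ρ hρ
  -- The rate at an intermediate center `t` is never worse than at `v₀`. For `v₀ ≤ v` the product is
  -- `e^v - e^t`, which decreases in `t`; for `v ≤ v₀` both factors increase in `t`.
  have hgeom : ∀ t ∈ Set.uIcc v₀ v, |v - t| ≤ L ∧ Real.exp t ≤ Real.exp (v₀ + L) ∧
      Real.exp t * (Real.exp |v - t| - 1) ≤ Real.exp v₀ * (Real.exp L - 1) := by
    intro t ht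
    rcases le_total v₀ v with h | h
    · rw [Set.uIcc_of_le h] at ht
      rw [hL, abs_of_nonneg (sub_nonneg.2 ht.2), abs_of_nonneg (sub_nonneg.2 h)]
      refine ⟨by linarith [ht.1], Real.exp_le_exp.2 (by linarith [ht.2]), ?_⟩
      rw [mul_sub, mul_sub, ← Real.exp_add, ← Real.exp_add, add_sub_cancel, add_sub_cancel]
      linarith [Real.exp_le_exp.2 ht.1]
    · rw [Set.uIcc_of_ge h] at ht
      rw [hL, abs_of_nonpos (sub_nonpos.2 ht.1), abs_of_nonpos (sub_nonpos.2 h)]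
      refine ⟨by linarith [ht.2], Real.exp_le_exp.2 (by linarith [ht.2]), ?_⟩
      have h2 : Real.exp (-(v - t)) ≤ Real.exp (-(v - v₀)) :=
        Real.exp_le_exp.2 (by linarith [ht.2])
      have h3 : (0 : ℝ) ≤ Real.exp (-(v - t)) - 1 := by
        linarith [Real.add_one_le_exp (-(v - t)), ht.1]
      have h4 : Real.exp t ≤ Real.exp v₀ := Real.exp_le_exp.2 ht.2
      gcongr
  -- The remainder pairs `D^(N+1)` with `Φ_N`, so `(N+1)! / N!` leaves a factor `N + 1`, harmless
  -- against `q ^ N`.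
  have hrem : ∀ N : ℕ, ‖g v - ∑ n ∈ Finset.range (N + 1), taylorTerm lam g v₀ n v‖ ≤
      C * (Real.exp (v₀ + L) * ρ) * Real.exp (b * L) * (((N : ℝ) + 1) * q ^ N) * L := by
    intro N
    refine norm_sub_sum_genDeriv_mul_le (fun n _ t ht => hg n t ht) fun t ht => ?_
    obtain ⟨ht1, ht2, ht3⟩ := hgeom t ht
    have hnt : ‖(v : ℂ) - t‖ = |v - t| := by
      rw [← Complex.ofReal_sub, Complex.norm_real, Real.norm_eq_abs]
    have hΦ := norm_fundamentalFunction_le hb N ((v : ℂ) - t)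
    rw [hnt] at hΦ
    have h5 : 0 ≤ Real.exp |v - t| - 1 := by
      linarith [Real.add_one_le_exp |v - t|, abs_nonneg (v - t)]
    rw [norm_mul]
    calc _ ≤ (C * (N + 1).factorial * (Real.exp t * ρ) ^ (N + 1)) *
          (Real.exp (b * |v - t|) * (Real.exp |v - t| - 1) ^ N / N.factorial) := by
          gcongr
          exact hCb (N + 1) t ht
      _ = C * (Real.exp t * ρ) * Real.exp (b * |v - t|) *
          (((N : ℝ) + 1) * (ρ * (Real.exp t * (Real.exp |v - t| - 1))) ^ N) := by
          have : (N.factorial : ℝ) ≠ 0 := by positivity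
          rw [Nat.factorial_succ, pow_succ, mul_pow, mul_pow, mul_pow]
          push_cast
          field_simp
      _ ≤ _ := by
          have h6 : ρ * (Real.exp t * (Real.exp |v - t| - 1)) ≤ q := by
            calc _ ≤ ρ * (Real.exp v₀ * (Real.exp L - 1)) := by gcongr
              _ = q := by rw [hq]; ring
          gcongr
  have hz : Filter.Tendsto (fun N : ℕ => ((N : ℝ) + 1) * q ^ N) Filter.atTop (nhds 0) := by
    have h7 := (tendsto_self_mul_const_pow_of_lt_one hq0 hq1).add
      (tendsto_pow_atTop_nhds_zero_of_lt_one hq0 hq1)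
    rw [add_zero] at h7
    refine h7.congr fun N => by ring
  have hz' := (hz.const_mul (C * (Real.exp (v₀ + L) * ρ) * Real.exp (b * L))).mul_const L
  rw [mul_zero, zero_mul] at hz'
  rw [tendsto_iff_norm_sub_tendsto_zero]
  refine squeeze_zero (fun _ => norm_nonneg _) (fun N => ?_) hz'
  rw [norm_sub_rev]
  exact hrem N

end Convergence

/-! ### Derivatives along linear vector fields. -/

section VecDeriv

variable {E : Type*} [NormedAddCommGroup E] [NormedSpace ℝ E]

/-- The derivative of `h` along the linear vector field `x ↦ A x`. -/
def vecDeriv (A : E →L[ℝ] E) (h : E → ℂ) (x : E) : ℂ := fderiv ℝ h x (A x)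

lemma vecDeriv_mul {A : E →L[ℝ] E} {h y : E → ℂ} {x : E} (hh : DifferentiableAt ℝ h x)
    (hy : DifferentiableAt ℝ y x) :
    vecDeriv A (fun x => h x * y x) x = vecDeriv A h x * y x + h x * vecDeriv A y x := by
  unfold vecDeriv
  rw [fderiv_fun_mul hh hy]
  simp
  ring

/-- No factor `r` remains, because a linear field commutes with dilations. -/
lemma vecDeriv_comp_smul {A : E →L[ℝ] E} {h : E → ℂ} {x : E} {r : ℝ}
    (hh : DifferentiableAt ℝ h (r • x)) :
    vecDeriv A (fun x => h (r • x)) x = vecDeriv A h (r • x) := by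
  unfold vecDeriv
  have h1 : HasFDerivAt (fun x : E => r • x) (r • ContinuousLinearMap.id ℝ E) x :=
    (hasFDerivAt_id x).const_smul r
  have h2 := (hh.hasFDerivAt.comp x h1).fderiv
  change fderiv ℝ (fun x => h (r • x)) x = _ at h2
  rw [h2]
  simp

lemma contDiffOn_vecDeriv (A : E →L[ℝ] E) {h : E → ℂ} {G : Set E} (hG : IsOpen G)
    (hh : ContDiffOn ℝ ∞ h G) : ContDiffOn ℝ ∞ (vecDeriv A h) G :=
  (hh.fderiv_of_isOpen hG (by simp)).clm_apply A.contDiff.contDiffOn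

/-- The first-order term comes from differentiating the field `x ↦ B x` itself. -/
lemma vecDeriv_vecDeriv (A B : E →L[ℝ] E) {h : E → ℂ} {x : E} (hh : ContDiffAt ℝ ∞ h x) :
    vecDeriv A (vecDeriv B h) x =
      fderiv ℝ (fderiv ℝ h) x (A x) (B x) + fderiv ℝ h x (B (A x)) := by
  have h1 : HasFDerivAt (fderiv ℝ h) (fderiv ℝ (fderiv ℝ h) x) x :=
    ((hh.fderiv_right (m := 1) (by norm_cast)).differentiableAt one_ne_zero).hasFDerivAt
  have h2 := (h1.clm_apply B.hasFDerivAt).fderiv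
  change fderiv ℝ (vecDeriv B h) x = _ at h2
  rw [vecDeriv, h2]
  simp [add_comm]

end VecDeriv

/-! ### Rotation invariance and integration by parts on the sphere. -/

section Sphere

open MeasureTheory
open scoped Pointwise

/-- Differentiation under the integral sign over a compact space. -/
lemma hasDerivAt_integral_of_compactSpace {X : Type*} [TopologicalSpace X] [CompactSpace X]
    [MeasurableSpace X] [BorelSpace X] {μ : Measure X} [IsFiniteMeasure μ]
    {F F' : ℝ → X → ℂ} {U : Set ℝ} (hU : IsOpen U) {t₀ : ℝ} (ht₀ : t₀ ∈ U)
    (hF : ∀ t ∈ U, Continuous (F t))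
    (hF' : ContinuousOn (fun p : ℝ × X => F' p.1 p.2) (U ×ˢ Set.univ))
    (h : ∀ t ∈ U, ∀ x, HasDerivAt (fun t => F t x) (F' t x) t) :
    HasDerivAt (fun t => ∫ x, F t x ∂μ) (∫ x, F' t₀ x ∂μ) t₀ := by
  obtain ⟨δ, hδ, hsub⟩ := Metric.nhds_basis_closedBall.mem_iff.1 (hU.mem_nhds ht₀)
  obtain ⟨M, hM⟩ := ((isCompact_closedBall t₀ δ).prod
    (isCompact_univ (X := X))).exists_bound_of_continuousOn
      (hF'.mono (Set.prod_mono hsub subset_rfl))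
  have hcF' : Continuous (F' t₀) :=
    hF'.comp_continuous (f := fun x => (t₀, x)) (by fun_prop) fun x => ⟨ht₀, trivial⟩
  refine (hasDerivAt_integral_of_dominated_loc_of_deriv_le (bound := fun _ => M)
    (Metric.closedBall_mem_nhds t₀ hδ) ?_ ?_ hcF'.aestronglyMeasurable ?_
    (integrable_const M) ?_).2
  · filter_upwards [hU.mem_nhds ht₀] with t ht using (hF t ht).aestronglyMeasurable
  · exact (hF t₀ ht₀).integrable_of_hasCompactSupport (HasCompactSupport.of_compactSpace _)
  · exact Filter.Eventually.of_forall fun x t ht => hM (t, x) ⟨ht, trivial⟩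
  · exact Filter.Eventually.of_forall fun x t ht => h t (hsub ht) x

variable {E : Type*} [NormedAddCommGroup E] [InnerProductSpace ℝ E] [FiniteDimensional ℝ E]
  [MeasurableSpace E] [BorelSpace E]

/-- A linear isometry acts on the unit sphere. -/
def sphereHomeomorph (e : E ≃ₗᵢ[ℝ] E) : Metric.sphere (0 : E) 1 ≃ₜ Metric.sphere (0 : E) 1 where
  toFun θ := ⟨e θ, by simp⟩
  invFun θ := ⟨e.symm θ, by simp⟩
  left_inv θ := by simp
  right_inv θ := by simp
  continuous_toFun := by fun_prop
  continuous_invFun := by fun_prop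

/-- The surface measure of `s` is a constant times the volume of the cone over `s`, and a linear
isometry preserves volume and maps cones to cones. -/
lemma measurePreserving_sphereHomeomorph (e : E ≃ₗᵢ[ℝ] E) :
    MeasurePreserving (sphereHomeomorph e).toMeasurableEquiv
      (volume : Measure E).toSphere (volume : Measure E).toSphere := by
  refine ⟨(sphereHomeomorph e).toMeasurableEquiv.measurable, ?_⟩
  ext s hs
  rw [MeasurableEquiv.map_apply, Measure.toSphere_apply' _ hs, Measure.toSphere_apply' _
    ((sphereHomeomorph e).toMeasurableEquiv.measurable hs)]
  congr 1
  rw [← e.measurePreserving.measure_preimage_emb e.toHomeomorph.measurableEmbedding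
    (Set.Ioo (0 : ℝ) 1 • (Subtype.val '' s))]
  congr 1
  ext x
  simp only [Set.mem_smul, Set.mem_preimage, Set.mem_image]
  constructor
  · rintro ⟨c, hc, _, ⟨θ, hθ, rfl⟩, rfl⟩
    exact ⟨c, hc, _, ⟨_, hθ, rfl⟩, by simp [sphereHomeomorph]⟩
  · rintro ⟨c, hc, _, ⟨θ, hθ, rfl⟩, hx⟩
    refine ⟨c, hc, _, ⟨(sphereHomeomorph e).symm θ, ?_, rfl⟩, e.injective ?_⟩
    · change (sphereHomeomorph e) ((sphereHomeomorph e).symm θ) ∈ s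
      rwa [Homeomorph.apply_symm_apply]
    rw [← hx]
    have h := congrArg Subtype.val ((sphereHomeomorph e).apply_symm_apply θ)
    change e ((sphereHomeomorph e).symm θ : E) = θ at h
    rw [map_smul, h]

lemma integral_sphere_comp_isometry (e : E ≃ₗᵢ[ℝ] E) (φ : E → ℂ) :
    ∫ θ : Metric.sphere (0 : E) 1, φ (e θ) ∂(volume : Measure E).toSphere =
      ∫ θ : Metric.sphere (0 : E) 1, φ θ ∂(volume : Measure E).toSphere :=
  (measurePreserving_sphereHomeomorph e).integral_comp' fun θ : Metric.sphere (0 : E) 1 => φ θ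

/-- Vector fields generating rotations integrate to zero over the unit sphere. -/
lemma integral_sphere_vecDeriv_eq_zero {A : E →L[ℝ] E} (hA : A ∈ skewAdjoint (E →L[ℝ] E))
    {G : Set E} (hG : IsOpen G) (hS : Metric.sphere (0 : E) 1 ⊆ G) {φ : E → ℂ}
    (hφ : ContDiffOn ℝ 1 φ G) :
    ∫ θ : Metric.sphere (0 : E) 1, vecDeriv A φ θ ∂(volume : Measure E).toSphere = 0 := by
  -- For skew-adjoint `A` the maps `exp(tA)` are rotations, so the integral of `φ ∘ exp(tA)` is
  -- constant in `t`; its derivative at `t = 0` is the integral in question.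
  have hu : ∀ t : ℝ, NormedSpace.exp (t • A) ∈ unitary (E →L[ℝ] E) := fun t => by
    let _ : NormedAlgebra ℚ (E →L[ℝ] E) := NormedAlgebra.restrictScalars ℚ ℝ _
    exact NormedSpace.exp_mem_unitary_of_mem_skewAdjoint (skewAdjoint.smul_mem t hA)
  let e : ℝ → E ≃ₗᵢ[ℝ] E := fun t => Unitary.linearIsometryEquiv ⟨_, hu t⟩
  have he : ∀ t x, e t x = NormedSpace.exp (t • A) x := fun t x => rfl
  have hmem : ∀ t (θ : Metric.sphere (0 : E) 1), NormedSpace.exp (t • A) (θ : E) ∈ G :=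
    fun t θ => hS (by rw [← he]; simp)
  have hexp : Continuous fun t : ℝ => NormedSpace.exp (t • A) :=
    continuous_iff_continuousAt.2 fun t => (hasDerivAt_exp_smul_const (𝕂 := ℝ) A t).continuousAt
  have hcont : Continuous fun p : ℝ × Metric.sphere (0 : E) 1 =>
      NormedSpace.exp (p.1 • A) (p.2 : E) :=
    (hexp.comp continuous_fst).clm_apply (continuous_subtype_val.comp continuous_snd)
  have hcont' : Continuous fun p : ℝ × Metric.sphere (0 : E) 1 =>
      (NormedSpace.exp (p.1 • A) * A) (p.2 : E) :=
    ((hexp.comp continuous_fst).mul continuous_const).clm_apply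
      (continuous_subtype_val.comp continuous_snd)
  have hφ' : ContinuousOn (fderiv ℝ φ) G := hφ.continuousOn_fderiv_of_isOpen hG le_rfl
  have hder := hasDerivAt_integral_of_compactSpace (μ := (volume : Measure E).toSphere)
    (F := fun t θ => φ (NormedSpace.exp (t • A) (θ : E)))
    (F' := fun t θ => fderiv ℝ φ (NormedSpace.exp (t • A) (θ : E))
      ((NormedSpace.exp (t • A) * A) (θ : E))) isOpen_univ (Set.mem_univ (0 : ℝ))
    (fun t _ => hφ.continuousOn.comp_continuous (by fun_prop) (hmem t))
    (Continuous.continuousOn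
      ((hφ'.comp_continuous hcont fun p => hmem p.1 p.2).clm_apply hcont'))
    (fun t _ θ => by
      have h1 := ((hφ.differentiableOn one_ne_zero).differentiableAt
        (hG.mem_nhds (hmem t θ))).hasFDerivAt
      have h2 := (hasDerivAt_exp_smul_const (𝕂 := ℝ) A t).clm_apply (hasDerivAt_const t (θ : E))
      refine (h1.comp_hasDerivAt t h2).congr_deriv ?_
      simp)
  have hconst : (fun t : ℝ => ∫ θ : Metric.sphere (0 : E) 1,
      φ (NormedSpace.exp (t • A) (θ : E)) ∂(volume : Measure E).toSphere) =
      fun _ => ∫ θ : Metric.sphere (0 : E) 1, φ θ ∂(volume : Measure E).toSphere :=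
    funext fun t => integral_sphere_comp_isometry (e t) φ
  rw [hconst] at hder
  have := hder.unique (hasDerivAt_const _ _)
  simpa [vecDeriv] using this

/-- Integration by parts on the sphere of radius `r` along a generator of rotations. -/
lemma integral_sphere_vecDeriv_mul {A : E →L[ℝ] E} (hA : A ∈ skewAdjoint (E →L[ℝ] E))
    {G : Set E} (hG : IsOpen G) {r : ℝ} (hS : ∀ θ : Metric.sphere (0 : E) 1, r • (θ : E) ∈ G)
    {h y : E → ℂ} (hh : ContDiffOn ℝ ∞ h G) (hy : ContDiff ℝ ∞ y) :
    ∫ θ : Metric.sphere (0 : E) 1, vecDeriv A h (r • (θ : E)) * y θ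
        ∂(volume : Measure E).toSphere =
      -∫ θ : Metric.sphere (0 : E) 1, h (r • (θ : E)) * vecDeriv A y θ
        ∂(volume : Measure E).toSphere := by
  have hcr : Continuous fun x : E => r • x := continuous_const_smul r
  have hG' : IsOpen ((fun x : E => r • x) ⁻¹' G) := hG.preimage hcr
  have hhr : ContDiffOn ℝ ∞ (fun x => h (r • x)) ((fun x : E => r • x) ⁻¹' G) :=
    hh.comp (contDiff_const_smul r).contDiffOn (fun x hx => hx)
  have h0 := integral_sphere_vecDeriv_eq_zero hA hG' (fun θ hθ => hS ⟨θ, hθ⟩)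
    (φ := fun x => h (r • x) * y x) ((hhr.mul hy.contDiffOn).of_le (by simp))
  have hvy : Continuous (vecDeriv A y) :=
    continuousOn_univ.1 (contDiffOn_vecDeriv A isOpen_univ hy.contDiffOn).continuousOn
  have hint : ∀ {p q : E → ℂ}, ContinuousOn p G → Continuous q →
      Integrable (fun θ : Metric.sphere (0 : E) 1 => p (r • (θ : E)) * q θ)
        (volume : Measure E).toSphere := fun {p q} hp hq =>
    Continuous.integrable_of_hasCompactSupport
      ((hp.comp_continuous (by fun_prop) hS).mul (hq.comp continuous_subtype_val))
      (HasCompactSupport.of_compactSpace _)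
  rw [← add_eq_zero_iff_eq_neg, ← integral_add
    (hint (contDiffOn_vecDeriv A hG hh).continuousOn hy.continuous) (hint hh.continuousOn hvy),
    ← h0]
  refine integral_congr_ae (Filter.Eventually.of_forall fun θ => ?_)
  have hd : DifferentiableAt ℝ h (r • (θ : E)) :=
    (hh.differentiableOn (by simp)).differentiableAt (hG.mem_nhds (hS θ))
  have hd' : DifferentiableAt ℝ (fun x => h (r • x)) (θ : E) :=
    (hhr.differentiableOn (by simp)).differentiableAt (hG'.mem_nhds (hS θ))
  simp only
  rw [vecDeriv_mul hd' (hy.differentiable (by simp) _), vecDeriv_comp_smul hd]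

end Sphere

/-! ### Rotation generators and the polar form of the Laplacian. -/

section Euclidean

variable {d : ℕ}

/-- The generator `x ↦ x_i e_j - x_j e_i` of the rotations in a coordinate plane. -/
def rotationGen (i j : Fin d) : EuclideanSpace ℝ (Fin d) →L[ℝ] EuclideanSpace ℝ (Fin d) :=
  (EuclideanSpace.proj i).smulRight (EuclideanSpace.single j (1 : ℝ)) -
    (EuclideanSpace.proj j).smulRight (EuclideanSpace.single i (1 : ℝ))

lemma rotationGen_apply (i j : Fin d) (x : EuclideanSpace ℝ (Fin d)) :
    rotationGen i j x = x i • EuclideanSpace.single j (1 : ℝ) -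
      x j • EuclideanSpace.single i (1 : ℝ) := rfl

lemma rotationGen_mem_skewAdjoint (i j : Fin d) :
    rotationGen i j ∈
      skewAdjoint (EuclideanSpace ℝ (Fin d) →L[ℝ] EuclideanSpace ℝ (Fin d)) := by
  rw [skewAdjoint.mem_iff, ContinuousLinearMap.star_eq_adjoint, eq_comm,
    ContinuousLinearMap.eq_adjoint_iff]
  intro x y
  simp only [_root_.neg_apply, rotationGen_apply, inner_neg_left, inner_sub_left,
    inner_sub_right, inner_smul_left, inner_smul_right, EuclideanSpace.inner_single_left,
    EuclideanSpace.inner_single_right]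
  simp
  ring

/-- For `i ≠ j` the square is minus the projection onto a coordinate plane, for `i = j` it vanishes;
each axis lies in the planes of `2(d - 1)` ordered pairs. -/
lemma sum_rotationGen_rotationGen (x : EuclideanSpace ℝ (Fin d)) :
    ∑ i, ∑ j, rotationGen i j (rotationGen i j x) = (2 - 2 * (d : ℝ)) • x := by
  have h : ∀ i j : Fin d, rotationGen i j (rotationGen i j x) =
      (if i = j then 2 * x i else 0) • EuclideanSpace.single i (1 : ℝ) -
        (x i • EuclideanSpace.single i (1 : ℝ) + x j • EuclideanSpace.single j (1 : ℝ)) := by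
    intro i j
    rw [rotationGen_apply i j x, map_sub, map_smul, map_smul]
    simp only [rotationGen_apply]
    by_cases hij : i = j
    · subst hij
      simp
      module
    · simp [hij, Ne.symm hij]
      module
  have hx : ∑ i, x i • EuclideanSpace.single i (1 : ℝ) = x := by
    simpa using (EuclideanSpace.basisFun (Fin d) ℝ).sum_repr x
  simp only [h, Finset.sum_sub_distrib, Finset.sum_add_distrib, ite_smul, zero_smul,
    Finset.sum_ite_eq, Finset.mem_univ, if_true, Finset.sum_const, Finset.card_univ,
    Fintype.card_fin, mul_smul, ← Finset.smul_sum, hx]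
  module

/-- With the second derivative as `Q`, the trace is the Laplacian and `Q x x` the second radial
derivative. Summing over ordered pairs makes symmetry of `Q` unnecessary. -/
lemma sum_bilin_rotationGen
    (Q : EuclideanSpace ℝ (Fin d) →L[ℝ] EuclideanSpace ℝ (Fin d) →L[ℝ] ℂ)
    (x : EuclideanSpace ℝ (Fin d)) :
    ∑ i, ∑ j, Q (rotationGen i j x) (rotationGen i j x) =
      2 * ((‖x‖ ^ 2 : ℝ) : ℂ) *
        ∑ i, Q (EuclideanSpace.single i (1 : ℝ)) (EuclideanSpace.single i (1 : ℝ)) -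
      2 * Q x x := by
  have hx : ∑ i, x i • EuclideanSpace.single i (1 : ℝ) = x := by
    simpa using (EuclideanSpace.basisFun (Fin d) ℝ).sum_repr x
  have hQ : Q x x = ∑ i, ∑ j, (x i : ℂ) * x j *
      Q (EuclideanSpace.single i (1 : ℝ)) (EuclideanSpace.single j (1 : ℝ)) := by
    conv_lhs => rw [← hx]
    simp only [map_sum, map_smul, _root_.sum_apply, _root_.smul_apply,
      Finset.smul_sum, Complex.real_smul]
    rw [Finset.sum_comm]
    refine Finset.sum_congr rfl fun i _ => Finset.sum_congr rfl fun j _ => by ring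
  have hn : ((‖x‖ ^ 2 : ℝ) : ℂ) = ∑ i, (x i : ℂ) ^ 2 := by
    rw [EuclideanSpace.norm_sq_eq]
    simp
  have h : ∀ i j : Fin d, Q (rotationGen i j x) (rotationGen i j x) =
      (x i : ℂ) ^ 2 * Q (EuclideanSpace.single j (1 : ℝ)) (EuclideanSpace.single j (1 : ℝ)) +
      (x j : ℂ) ^ 2 * Q (EuclideanSpace.single i (1 : ℝ)) (EuclideanSpace.single i (1 : ℝ)) -
      (x i : ℂ) * x j * Q (EuclideanSpace.single i (1 : ℝ)) (EuclideanSpace.single j (1 : ℝ)) -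
      (x j : ℂ) * x i * Q (EuclideanSpace.single j (1 : ℝ)) (EuclideanSpace.single i (1 : ℝ)) := by
    intro i j
    simp only [rotationGen_apply, map_sub, map_smul, _root_.sub_apply,
      _root_.smul_apply, Complex.real_smul]
    ring
  simp only [h, Finset.sum_sub_distrib, Finset.sum_add_distrib]
  rw [Finset.sum_comm (f := fun i j => (x j : ℂ) * x i *
      Q (EuclideanSpace.single j (1 : ℝ)) (EuclideanSpace.single i (1 : ℝ))), ← hQ,
    Finset.sum_comm (f := fun i j => (x j : ℂ) ^ 2 *
      Q (EuclideanSpace.single i (1 : ℝ)) (EuclideanSpace.single i (1 : ℝ))), hn,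
    mul_assoc, Finset.sum_mul_sum]
  ring

lemma laplacian_apply (h : EuclideanSpace ℝ (Fin d) → ℂ) (x : EuclideanSpace ℝ (Fin d)) :
    Laplacian.laplacian h x = ∑ i, fderiv ℝ (fderiv ℝ h) x
      (EuclideanSpace.single i (1 : ℝ)) (EuclideanSpace.single i (1 : ℝ)) := by
  rw [InnerProductSpace.laplacian_eq_iteratedFDeriv_orthonormalBasis h
    (EuclideanSpace.basisFun (Fin d) ℝ)]
  simp [iteratedFDeriv_two_apply]

/-- The derivative `x ↦ ∑ x_i ∂_i h` along the radial vector field. -/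
def euler (h : EuclideanSpace ℝ (Fin d) → ℂ) : EuclideanSpace ℝ (Fin d) → ℂ :=
  vecDeriv (ContinuousLinearMap.id ℝ _) h

/-- The decomposition of the Laplacian into its radial and spherical parts. -/
lemma norm_sq_mul_laplacian {h : EuclideanSpace ℝ (Fin d) → ℂ} {x : EuclideanSpace ℝ (Fin d)}
    (hh : ContDiffAt ℝ ∞ h x) :
    ((‖x‖ ^ 2 : ℝ) : ℂ) * Laplacian.laplacian h x =
      euler (euler h) x + ((d : ℂ) - 2) * euler h x +
        2⁻¹ * ∑ i, ∑ j, vecDeriv (rotationGen i j) (vecDeriv (rotationGen i j) h) x := by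
  -- After halving, this contributes `(1 - d) Dh(x)x`, which cancels the first-order terms `1 + (d -
  -- 2)` of the Euler part.
  have h1 : ∑ i, ∑ j, fderiv ℝ h x (rotationGen i j (rotationGen i j x)) =
      (2 - 2 * (d : ℂ)) * fderiv ℝ h x x := by
    simp only [← map_sum, sum_rotationGen_rotationGen, map_smul, Complex.real_smul]
    push_cast
    ring
  simp only [euler, vecDeriv_vecDeriv _ _ hh, Finset.sum_add_distrib, sum_bilin_rotationGen, h1,
    laplacian_apply, ContinuousLinearMap.id_apply]
  simp only [vecDeriv, ContinuousLinearMap.id_apply]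
  ring

lemma contDiffOn_laplacian {h : EuclideanSpace ℝ (Fin d) → ℂ}
    {G : Set (EuclideanSpace ℝ (Fin d))} (hG : IsOpen G) (hh : ContDiffOn ℝ ∞ h G) :
    ContDiffOn ℝ ∞ (Laplacian.laplacian h : EuclideanSpace ℝ (Fin d) → ℂ) G := by
  have h1 : ContDiffOn ℝ ∞ (fderiv ℝ (fderiv ℝ h)) G :=
    (hh.fderiv_of_isOpen hG (m := ∞) (by simp)).fderiv_of_isOpen hG (by simp)
  have h2 : (Laplacian.laplacian h : EuclideanSpace ℝ (Fin d) → ℂ) = fun x =>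
      ∑ i, fderiv ℝ (fderiv ℝ h) x
        (EuclideanSpace.single i (1 : ℝ)) (EuclideanSpace.single i (1 : ℝ)) :=
    funext (laplacian_apply h)
  rw [h2]
  exact ContDiffOn.sum fun i _ =>
    (h1.clm_apply contDiffOn_const).clm_apply contDiffOn_const

lemma contDiffOn_iterate_laplacian {h : EuclideanSpace ℝ (Fin d) → ℂ}
    {G : Set (EuclideanSpace ℝ (Fin d))} (hG : IsOpen G) (hh : ContDiffOn ℝ ∞ h G) (p : ℕ) :
    ContDiffOn ℝ ∞ ((Laplacian.laplacian : (EuclideanSpace ℝ (Fin d) → ℂ) →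
      EuclideanSpace ℝ (Fin d) → ℂ)^[p] h) G := by
  induction p with
  | zero => exact hh
  | succ p ih =>
    rw [Function.iterate_succ_apply']
    exact contDiffOn_laplacian hG ih

end Euclidean

/-! ### Harmonic homogeneous polynomials as spherical eigenfunctions. -/

section HarmonicPolynomials

variable {d : ℕ}

lemma hasFDerivAt_evalReal (P : MvPolynomial (Fin d) ℂ) (x : EuclideanSpace ℝ (Fin d)) :
    HasFDerivAt (evalReal P)
      (∑ i, (EuclideanSpace.proj i : EuclideanSpace ℝ (Fin d) →L[ℝ] ℝ).smulRight
        (evalReal (MvPolynomial.pderiv i P) x)) x := by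
  induction P using MvPolynomial.induction_on with
  | C a =>
    have h : evalReal (MvPolynomial.C a : MvPolynomial (Fin d) ℂ) = fun _ => a := by
      ext; simp [evalReal]
    rw [h]
    refine (hasFDerivAt_const a x).congr_fderiv ?_
    ext w
    simp [evalReal]
  | add P Q hP hQ =>
    have h : evalReal (P + Q) = fun x => evalReal P x + evalReal Q x := by
      ext; simp [evalReal]
    rw [h]
    refine (hP.add hQ).congr_fderiv ?_
    ext w
    simp [evalReal, Finset.sum_add_distrib]
  | mul_X P j hP =>
    have h : evalReal (P * MvPolynomial.X j) = fun x => evalReal P x * ((x j : ℝ) : ℂ) := by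
      ext; simp [evalReal]
    rw [h]
    have hj : HasFDerivAt (fun x : EuclideanSpace ℝ (Fin d) => ((x j : ℝ) : ℂ))
        (Complex.ofRealCLM.comp (EuclideanSpace.proj j)) x :=
      (Complex.ofRealCLM.comp
        (EuclideanSpace.proj j : EuclideanSpace ℝ (Fin d) →L[ℝ] ℝ)).hasFDerivAt
    refine (hP.mul hj).congr_fderiv ?_
    ext w
    simp [evalReal, MvPolynomial.pderiv_X, Pi.single_apply,
      Finset.sum_add_distrib, Finset.mul_sum, apply_ite]
    congr 1
    · ring
    · exact Finset.sum_congr rfl fun i _ => by ring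

lemma contDiff_evalReal (P : MvPolynomial (Fin d) ℂ) : ContDiff ℝ ∞ (evalReal P) := by
  induction P using MvPolynomial.induction_on with
  | C a =>
    have h : evalReal (MvPolynomial.C a : MvPolynomial (Fin d) ℂ) = fun _ => a := by
      ext; simp [evalReal]
    rw [h]
    exact contDiff_const
  | add P Q hP hQ =>
    have h : evalReal (P + Q) = fun x => evalReal P x + evalReal Q x := by
      ext; simp [evalReal]
    rw [h]
    exact hP.add hQ
  | mul_X P j hP =>
    have h : evalReal (P * MvPolynomial.X j) = fun x => evalReal P x * ((x j : ℝ) : ℂ) := by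
      ext; simp [evalReal]
    rw [h]
    exact hP.mul (Complex.ofRealCLM.comp
        (EuclideanSpace.proj j : EuclideanSpace ℝ (Fin d) →L[ℝ] ℝ)).contDiff

lemma laplacian_evalReal (P : MvPolynomial (Fin d) ℂ) (x : EuclideanSpace ℝ (Fin d)) :
    Laplacian.laplacian (evalReal P) x = evalReal (polyLaplacian d P) x := by
  have h1 : fderiv ℝ (evalReal P) = fun x => ∑ i,
      (EuclideanSpace.proj i : EuclideanSpace ℝ (Fin d) →L[ℝ] ℝ).smulRight
        (evalReal (MvPolynomial.pderiv i P) x) :=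
    funext fun x => (hasFDerivAt_evalReal P x).fderiv
  have h2 : HasFDerivAt (fderiv ℝ (evalReal P)) (∑ i : Fin d,
      ((ContinuousLinearMap.smulRightL ℝ (EuclideanSpace ℝ (Fin d)) ℂ)
        (EuclideanSpace.proj i : EuclideanSpace ℝ (Fin d) →L[ℝ] ℝ)).comp
        (∑ j, (EuclideanSpace.proj j : EuclideanSpace ℝ (Fin d) →L[ℝ] ℝ).smulRight
          (evalReal (MvPolynomial.pderiv j (MvPolynomial.pderiv i P)) x))) x := by
    rw [h1]
    refine HasFDerivAt.fun_sum fun i _ => ?_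
    exact (((ContinuousLinearMap.smulRightL ℝ (EuclideanSpace ℝ (Fin d)) ℂ)
        (EuclideanSpace.proj i : EuclideanSpace ℝ (Fin d) →L[ℝ] ℝ)).hasFDerivAt).comp x
      (hasFDerivAt_evalReal (MvPolynomial.pderiv i P) x)
  rw [laplacian_apply, h2.fderiv]
  simp [evalReal, polyLaplacian]

lemma euler_evalReal {k : ℕ} {P : MvPolynomial (Fin d) ℂ} (hP : P.IsHomogeneous k)
    (x : EuclideanSpace ℝ (Fin d)) : euler (evalReal P) x = k * evalReal P x := by
  rw [euler, vecDeriv, (hasFDerivAt_evalReal P x).fderiv]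
  have h := congrArg (fun Q => evalReal Q x) hP.sum_X_mul_pderiv
  simpa [evalReal] using h

/-- The conjugate of a harmonic homogeneous polynomial is a harmonic homogeneous polynomial. -/
lemma exists_conj_evalReal {k : ℕ} {P : MvPolynomial (Fin d) ℂ}
    (hP : P ∈ harmonicHomogeneous d k) :
    ∃ Q ∈ harmonicHomogeneous d k, ∀ x, (starRingEnd ℂ) (evalReal P x) = evalReal Q x := by
  refine ⟨MvPolynomial.map (starRingEnd ℂ) P, ⟨?_, ?_⟩, fun x => ?_⟩
  · exact ((MvPolynomial.mem_homogeneousSubmodule k P).1 hP.1).map _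
  · have h := congrArg (MvPolynomial.map (starRingEnd ℂ)) (LinearMap.mem_ker.1 hP.2)
    refine LinearMap.mem_ker.2 ?_
    simpa [polyLaplacian, MvPolynomial.pderiv_map] using h
  · rw [evalReal, evalReal, MvPolynomial.map_eval]
    congr 2
    ext i
    simp

/-- Harmonic homogeneous polynomials are eigenfunctions of the spherical Laplacian. -/
lemma sum_rotation_evalReal {k : ℕ} {Q : MvPolynomial (Fin d) ℂ}
    (hQ : Q ∈ harmonicHomogeneous d k) {x : EuclideanSpace ℝ (Fin d)} :
    2⁻¹ * ∑ i, ∑ j, vecDeriv (rotationGen i j) (vecDeriv (rotationGen i j) (evalReal Q)) x =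
      -((k : ℂ) * (k + d - 2)) * evalReal Q x := by
  have hhom := (MvPolynomial.mem_homogeneousSubmodule k Q).1 hQ.1
  -- The left side vanishes by harmonicity and the Euler field multiplies by `k`, which leaves `-(k²
  -- + (d - 2)k)` for the spherical part.
  have h := norm_sq_mul_laplacian (contDiff_evalReal Q).contDiffAt (x := x)
  have he : euler (evalReal Q) = fun x => (k : ℂ) * evalReal Q x :=
    funext (euler_evalReal hhom)
  have hee : euler (euler (evalReal Q)) x = (k : ℂ) * (k * evalReal Q x) := by
    rw [he, ← euler_evalReal hhom x, euler, vecDeriv, euler, vecDeriv,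
      fderiv_const_mul ((contDiff_evalReal Q).differentiable (by simp) x)]
    simp
  rw [laplacian_evalReal, LinearMap.mem_ker.1 hQ.2, hee, euler_evalReal hhom] at h
  simp only [evalReal, map_zero, mul_zero] at h ⊢
  linear_combination -h

end HarmonicPolynomials

/-! ### Spherical coefficients in the logarithmic radius. -/

section Coefficients

open MeasureTheory

variable {d : ℕ} {r₀ : ℝ} {r₁ : EReal}

/-- The logarithms of the radii of the spheres that are contained in the annulus. -/
def logRadii (r₀ : ℝ) (r₁ : EReal) : Set ℝ :=
  {v | r₀ < Real.exp v ∧ ((Real.exp v : ℝ) : EReal) < r₁}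

lemma isOpen_logRadii (r₀ : ℝ) (r₁ : EReal) : IsOpen (logRadii r₀ r₁) :=
  (isOpen_lt continuous_const Real.continuous_exp).inter
    (isOpen_lt (continuous_coe_real_ereal.comp Real.continuous_exp) continuous_const)

lemma Icc_subset_logRadii {a b : ℝ} (ha : a ∈ logRadii r₀ r₁) (hb : b ∈ logRadii r₀ r₁) :
    Set.Icc a b ⊆ logRadii r₀ r₁ := fun _ hv =>
  ⟨ha.1.trans_le (Real.exp_le_exp.2 hv.1),
    (EReal.coe_le_coe_iff.2 (Real.exp_le_exp.2 hv.2)).trans_lt hb.2⟩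

lemma isOpen_annulus (d : ℕ) (r₀ : ℝ) (r₁ : EReal) : IsOpen (annulus d r₀ r₁) :=
  (isOpen_lt continuous_const continuous_norm).inter
    (isOpen_lt (continuous_coe_real_ereal.comp continuous_norm) continuous_const)

lemma norm_exp_smul_sphere (v : ℝ) (θ : Metric.sphere (0 : EuclideanSpace ℝ (Fin d)) 1) :
    ‖Real.exp v • (θ : EuclideanSpace ℝ (Fin d))‖ = Real.exp v := by
  rw [norm_smul, norm_eq_of_mem_sphere, mul_one, Real.norm_of_nonneg (Real.exp_pos v).le]

lemma exp_smul_mem_annulus {v : ℝ} (hv : v ∈ logRadii r₀ r₁)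
    (θ : Metric.sphere (0 : EuclideanSpace ℝ (Fin d)) 1) :
    Real.exp v • (θ : EuclideanSpace ℝ (Fin d)) ∈ annulus d r₀ r₁ := by
  unfold annulus
  rw [Set.mem_ofPred_eq, norm_exp_smul_sphere]
  exact hv

/-- The integral of `h` against `y` over the sphere of radius `e^v`. -/
def sphereCoeff (y h : EuclideanSpace ℝ (Fin d) → ℂ) (v : ℝ) : ℂ :=
  ∫ θ : Metric.sphere (0 : EuclideanSpace ℝ (Fin d)) 1,
    h (Real.exp v • (θ : EuclideanSpace ℝ (Fin d))) * y θ ∂(volume.toSphere)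

lemma integrable_sphere {y h : EuclideanSpace ℝ (Fin d) → ℂ} {v : ℝ}
    (hv : v ∈ logRadii r₀ r₁) (hh : ContinuousOn h (annulus d r₀ r₁)) (hy : Continuous y) :
    Integrable (fun θ : Metric.sphere (0 : EuclideanSpace ℝ (Fin d)) 1 =>
      h (Real.exp v • (θ : EuclideanSpace ℝ (Fin d))) * y θ) (volume.toSphere) :=
  Continuous.integrable_of_hasCompactSupport
    ((hh.comp_continuous (by fun_prop) (exp_smul_mem_annulus hv)).mul
      (hy.comp continuous_subtype_val)) (HasCompactSupport.of_compactSpace _)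

/-- Moving `v` moves the point `e^v θ` with velocity equal to its position, so `d/dv` acts under the
integral as the Euler field. -/
lemma hasDerivAt_sphereCoeff {y h : EuclideanSpace ℝ (Fin d) → ℂ} {v : ℝ}
    (hv : v ∈ logRadii r₀ r₁) (hh : ContDiffOn ℝ ∞ h (annulus d r₀ r₁)) (hy : Continuous y) :
    HasDerivAt (sphereCoeff y h) (sphereCoeff y (euler h) v) v := by
  have hG := isOpen_annulus d r₀ r₁
  have hyS : Continuous fun θ : Metric.sphere (0 : EuclideanSpace ℝ (Fin d)) 1 => y θ :=
    hy.comp continuous_subtype_val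
  refine hasDerivAt_integral_of_compactSpace
    (X := Metric.sphere (0 : EuclideanSpace ℝ (Fin d)) 1)
    (F := fun v θ => h (Real.exp v • (θ : EuclideanSpace ℝ (Fin d))) * y θ)
    (F' := fun v θ => euler h (Real.exp v • (θ : EuclideanSpace ℝ (Fin d))) * y θ)
    (isOpen_logRadii r₀ r₁) hv (fun t ht => ?_) ?_ fun t ht θ => ?_
  · exact (hh.continuousOn.comp_continuous (by fun_prop) (exp_smul_mem_annulus ht)).mul hyS
  · refine ContinuousOn.mul ?_ (hyS.comp continuous_snd).continuousOn
    exact (contDiffOn_vecDeriv _ hG hh).continuousOn.comp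
      (Continuous.continuousOn (by fun_prop)) fun p hp => exp_smul_mem_annulus hp.1 p.2
  · have h1 := ((hh.differentiableOn (by simp)).differentiableAt
      (hG.mem_nhds (exp_smul_mem_annulus ht θ))).hasFDerivAt
    have h2 := (Real.hasDerivAt_exp t).smul_const (θ : EuclideanSpace ℝ (Fin d))
    exact (h1.comp_hasDerivAt t h2).mul_const (y θ)

/-- The radial form of the Laplacian on the coefficients of a smooth function. -/
lemma exp_mul_sphereCoeff_laplacian {k : ℕ} {Q : MvPolynomial (Fin d) ℂ}
    (hQ : Q ∈ harmonicHomogeneous d k) {h : EuclideanSpace ℝ (Fin d) → ℂ} {v : ℝ}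
    (hv : v ∈ logRadii r₀ r₁) (hh : ContDiffOn ℝ ∞ h (annulus d r₀ r₁)) :
    Complex.exp (2 * v) * sphereCoeff (evalReal Q) (Laplacian.laplacian h) v =
      sphereCoeff (evalReal Q) (euler (euler h)) v +
        ((d : ℂ) - 2) * sphereCoeff (evalReal Q) (euler h) v -
        (k : ℂ) * (k + d - 2) * sphereCoeff (evalReal Q) h v := by
  have hG := isOpen_annulus d r₀ r₁
  have hS := exp_smul_mem_annulus (d := d) hv
  have hy := contDiff_evalReal Q
  have hV : ∀ A {h : EuclideanSpace ℝ (Fin d) → ℂ}, ContDiffOn ℝ ∞ h (annulus d r₀ r₁) →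
      ContDiffOn ℝ ∞ (vecDeriv A h) (annulus d r₀ r₁) := fun A _ hh => contDiffOn_vecDeriv A hG hh
  have hVy : ∀ A {y : EuclideanSpace ℝ (Fin d) → ℂ}, ContDiff ℝ ∞ y →
      ContDiff ℝ ∞ (vecDeriv A y) := fun A _ hy =>
    contDiffOn_univ.1 (contDiffOn_vecDeriv A isOpen_univ hy.contDiffOn)
  have hint : ∀ {p q : EuclideanSpace ℝ (Fin d) → ℂ}, ContDiffOn ℝ ∞ p (annulus d r₀ r₁) →
      ContDiff ℝ ∞ q → Integrable (fun θ : Metric.sphere (0 : EuclideanSpace ℝ (Fin d)) 1 =>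
        p (Real.exp v • (θ : EuclideanSpace ℝ (Fin d))) * q θ) (volume.toSphere) :=
    fun hp hq => integrable_sphere hv hp.continuousOn hq.continuous
  -- Two integrations by parts move the rotation fields from `h` to the polynomial, and the signs
  -- cancel.
  have hpart : ∀ i j : Fin d,
      sphereCoeff (evalReal Q) (vecDeriv (rotationGen i j) (vecDeriv (rotationGen i j) h)) v =
      sphereCoeff (vecDeriv (rotationGen i j) (vecDeriv (rotationGen i j) (evalReal Q))) h v := by
    intro i j
    have hA := rotationGen_mem_skewAdjoint i j
    unfold sphereCoeff
    rw [integral_sphere_vecDeriv_mul hA hG hS (hV _ hh) hy,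
      integral_sphere_vecDeriv_mul hA hG hS hh (hVy _ hy), neg_neg]
  have hsum : 2⁻¹ * ∑ i, ∑ j, sphereCoeff (evalReal Q)
      (vecDeriv (rotationGen i j) (vecDeriv (rotationGen i j) h)) v =
      -((k : ℂ) * (k + d - 2)) * sphereCoeff (evalReal Q) h v := by
    simp only [hpart]
    unfold sphereCoeff
    rw [← integral_const_mul]
    have : ∀ i, Integrable (fun θ : Metric.sphere (0 : EuclideanSpace ℝ (Fin d)) 1 => ∑ j,
        h (Real.exp v • (θ : EuclideanSpace ℝ (Fin d))) *
          vecDeriv (rotationGen i j) (vecDeriv (rotationGen i j) (evalReal Q)) θ)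
        (volume.toSphere) := fun i =>
      integrable_finsetSum _ fun j _ => hint hh (hVy _ (hVy _ hy))
    simp only [← integral_finsetSum _ fun j _ => hint hh (hVy _ (hVy _ hy))]
    rw [← integral_finsetSum _ fun i _ => this i, ← integral_const_mul]
    refine integral_congr_ae (Filter.Eventually.of_forall fun θ => ?_)
    simp only [← Finset.mul_sum]
    rw [mul_left_comm, sum_rotation_evalReal hQ]
    ring
  -- With the eigenvalue term written as rotation integrals of `h`, the claim is the integral of the
  -- pointwise polar decomposition.
  rw [sub_eq_add_neg, ← neg_mul, ← hsum]
  have hE : ContDiffOn ℝ ∞ (euler h) (annulus d r₀ r₁) := hV _ hh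
  have hEE : ContDiffOn ℝ ∞ (euler (euler h)) (annulus d r₀ r₁) := hV _ hE
  have hXX := fun i j => hint (hV (rotationGen i j) (hV (rotationGen i j) hh)) hy
  unfold sphereCoeff
  simp only [← integral_finsetSum _ fun j _ => hXX _ j]
  rw [← integral_finsetSum _ fun i _ => integrable_finsetSum _ fun j _ => hXX i j,
    ← integral_const_mul, ← integral_const_mul, ← integral_const_mul,
    ← integral_add (hint hEE hy) ((hint hE hy).const_mul _),
    ← integral_add ((hint hEE hy).fun_add ((hint hE hy).const_mul _))
      ((integrable_finsetSum _ fun i _ => integrable_finsetSum _ fun j _ => hXX i j).const_mul _)]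
  refine integral_congr_ae (Filter.Eventually.of_forall fun θ => ?_)
  have key := norm_sq_mul_laplacian (hh.contDiffAt (hG.mem_nhds (hS θ)))
  rw [norm_exp_smul_sphere, ← Real.exp_nat_mul] at key
  push_cast at key
  simp only [← Finset.sum_mul]
  rw [← mul_assoc, key]
  ring

end Coefficients

/-! ### Generalized derivatives and iterated Laplacians. -/

section GenDeriv

variable {d k : ℕ} {r₀ : ℝ} {r₁ : EReal} {Q : MvPolynomial (Fin d) ℂ}

lemma exponent_two_mul (d k p : ℕ) : exponent d k (2 * p) = k + 2 * p := by
  simp [exponent]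

lemma exponent_two_mul_add_one (d k p : ℕ) :
    exponent d k (2 * p + 1) = -(k : ℂ) - d + 2 + 2 * p := by
  have h : (2 * p + 1) / 2 = p := by omega
  simp [exponent, h]

/-- Each parity class advances by `2` every second index, so the slope in `j` is `1`, as the
comparison with `b, b + 1, …` requires. -/
lemma norm_exponent_le (d k j : ℕ) : ‖exponent d k j‖ ≤ ((k : ℝ) + d + 2) + j := by
  have hj : 2 * ((j / 2 : ℕ) : ℝ) ≤ j := by
    have : 2 * (j / 2) ≤ j := Nat.mul_div_le j 2
    exact_mod_cast this
  have hd : (0 : ℝ) ≤ d := d.cast_nonneg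
  have h2 : ‖(2 : ℂ) * ((j / 2 : ℕ) : ℂ)‖ = 2 * ((j / 2 : ℕ) : ℝ) := by
    rw [norm_mul, Complex.norm_natCast, Complex.norm_two]
  unfold exponent
  split_ifs
  · refine (norm_add_le _ _).trans ?_
    rw [h2, Complex.norm_natCast]
    linarith
  · refine (norm_add_le _ _).trans ?_
    have h3 : ‖-(k : ℂ) - d + 2‖ ≤ k + d + 2 := by
      refine (norm_add_le _ _).trans ?_
      rw [Complex.norm_two]
      gcongr
      refine (norm_sub_le _ _).trans ?_
      rw [norm_neg, Complex.norm_natCast, Complex.norm_natCast]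
    rw [h2]
    linarith

lemma deriv_eq_of_eqOn {U : Set ℝ} (hU : IsOpen U) {g₁ g₂ : ℝ → ℂ} (h : Set.EqOn g₁ g₂ U)
    {v : ℝ} (hv : v ∈ U) {g' : ℂ} (hg : HasDerivAt g₂ g' v) : HasDerivAt g₁ g' v :=
  hg.congr_of_eventuallyEq (h.eventuallyEq_of_mem (hU.mem_nhds hv))

lemma hasDerivAt_exp_mul {c : ℂ} {g : ℝ → ℂ} {g' : ℂ} {v : ℝ} (hg : HasDerivAt g g' v) :
    HasDerivAt (fun v : ℝ => Complex.exp (c * v) * g v)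
      (Complex.exp (c * v) * (g' + c * g v)) v := by
  have h : HasDerivAt (fun v : ℂ => Complex.exp (c * v)) (Complex.exp (c * v) * (c * 1)) (v : ℂ) :=
    ((hasDerivAt_id (v : ℂ)).const_mul c).cexp
  refine (h.comp_ofReal.mul hg).congr_deriv ?_
  ring

variable (hQ : Q ∈ harmonicHomogeneous d k) {h : EuclideanSpace ℝ (Fin d) → ℂ}
  (hh : ContDiffOn ℝ ∞ h (annulus d r₀ r₁)) {g : ℝ → ℂ} {p : ℕ}
  (hg : Set.EqOn (genDeriv (exponent d k) (2 * p) g)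
    (fun v => Complex.exp (2 * p * v) * sphereCoeff (evalReal Q) h v) (logRadii r₀ r₁))

include hh hg

lemma hasDerivAt_genDeriv_even {v : ℝ} (hv : v ∈ logRadii r₀ r₁) :
    HasDerivAt (genDeriv (exponent d k) (2 * p) g) (Complex.exp (2 * p * v) *
      (sphereCoeff (evalReal Q) (euler h) v + 2 * p * sphereCoeff (evalReal Q) h v)) v :=
  deriv_eq_of_eqOn (isOpen_logRadii r₀ r₁) hg hv
    (hasDerivAt_exp_mul (hasDerivAt_sphereCoeff hv hh (contDiff_evalReal Q).continuous))

lemma genDeriv_odd_eqOn :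
    Set.EqOn (genDeriv (exponent d k) (2 * p + 1) g)
      (fun v => Complex.exp (2 * p * v) * (sphereCoeff (evalReal Q) (euler h) v -
        k * sphereCoeff (evalReal Q) h v)) (logRadii r₀ r₁) := by
  intro v hv
  simp only [genDeriv]
  rw [(hasDerivAt_genDeriv_even hh hg hv).deriv, hg hv, exponent_two_mul]
  ring

lemma hasDerivAt_genDeriv_odd {v : ℝ} (hv : v ∈ logRadii r₀ r₁) :
    HasDerivAt (genDeriv (exponent d k) (2 * p + 1) g) (Complex.exp (2 * p * v) *
      (sphereCoeff (evalReal Q) (euler (euler h)) v - k * sphereCoeff (evalReal Q) (euler h) v +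
        2 * p * (sphereCoeff (evalReal Q) (euler h) v - k * sphereCoeff (evalReal Q) h v))) v := by
  have hy := (contDiff_evalReal Q).continuous
  have hE : ContDiffOn ℝ ∞ (euler h) (annulus d r₀ r₁) :=
    contDiffOn_vecDeriv _ (isOpen_annulus d r₀ r₁) hh
  exact deriv_eq_of_eqOn (isOpen_logRadii r₀ r₁) (genDeriv_odd_eqOn hh hg) hv
    (hasDerivAt_exp_mul ((hasDerivAt_sphereCoeff hv hE hy).sub
      ((hasDerivAt_sphereCoeff hv hh hy).const_mul (k : ℂ))))

include hQ in
-- Conjugation by `e^{2pv}` lowers `λ_{2p}, λ_{2p+1}` to `λ_0, λ_1`, and `(E - k)(E + k + d - 2)`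
-- expands to the radial form of the Laplacian.
lemma genDeriv_add_two_eqOn :
    Set.EqOn (genDeriv (exponent d k) (2 * (p + 1)) g)
      (fun v => Complex.exp (2 * (p + 1 : ℕ) * v) *
        sphereCoeff (evalReal Q) (Laplacian.laplacian h) v) (logRadii r₀ r₁) := by
  intro v hv
  have h1 : genDeriv (exponent d k) (2 * (p + 1)) g v =
      deriv (genDeriv (exponent d k) (2 * p + 1) g) v -
        exponent d k (2 * p + 1) * genDeriv (exponent d k) (2 * p + 1) g v := rfl
  rw [h1, (hasDerivAt_genDeriv_odd hh hg hv).deriv, genDeriv_odd_eqOn hh hg hv,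
    exponent_two_mul_add_one]
  have h2 : Complex.exp (2 * (p + 1 : ℕ) * v) = Complex.exp (2 * p * v) * Complex.exp (2 * v) := by
    rw [← Complex.exp_add]
    congr 1
    push_cast
    ring
  simp only
  rw [h2, mul_assoc (Complex.exp (2 * p * v)), exp_mul_sphereCoeff_laplacian hQ hv hh]
  ring

omit hh hg

include hQ in
/-- The even generalized derivatives of the coefficients of `f` are, up to an exponential factor,
the coefficients of the iterated Laplacians of `f`. -/
lemma genDeriv_even_eqOn {f : EuclideanSpace ℝ (Fin d) → ℂ}
    (hf : ContDiffOn ℝ ∞ f (annulus d r₀ r₁)) (p : ℕ) :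
    Set.EqOn (genDeriv (exponent d k) (2 * p) (sphereCoeff (evalReal Q) f))
      (fun v => Complex.exp (2 * p * v) * sphereCoeff (evalReal Q)
        ((Laplacian.laplacian : (EuclideanSpace ℝ (Fin d) → ℂ) →
          EuclideanSpace ℝ (Fin d) → ℂ)^[p] f) v) (logRadii r₀ r₁) := by
  induction p with
  | zero => intro v _; simp [genDeriv]
  | succ p ih =>
    rw [Function.iterate_succ_apply']
    exact genDeriv_add_two_eqOn hQ
      (contDiffOn_iterate_laplacian (isOpen_annulus d r₀ r₁) hf p) ih

include hQ in
lemma differentiableAt_genDeriv {f : EuclideanSpace ℝ (Fin d) → ℂ}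
    (hf : ContDiffOn ℝ ∞ f (annulus d r₀ r₁)) (n : ℕ) {v : ℝ} (hv : v ∈ logRadii r₀ r₁) :
    DifferentiableAt ℝ (genDeriv (exponent d k) n (sphereCoeff (evalReal Q) f)) v := by
  have hs := contDiffOn_iterate_laplacian (isOpen_annulus d r₀ r₁) hf
  obtain ⟨p, rfl | rfl⟩ := n.even_or_odd'
  · exact (hasDerivAt_genDeriv_even (hs p) (genDeriv_even_eqOn hQ hf p) hv).differentiableAt
  · exact (hasDerivAt_genDeriv_odd (hs p) (genDeriv_even_eqOn hQ hf p) hv).differentiableAt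

include hQ in
-- By the same shift of exponents, odd orders need only a bound on `D^(1)` of the coefficients of
-- `Δ^p f`.
lemma genDeriv_odd_eqOn_genDeriv_one {f : EuclideanSpace ℝ (Fin d) → ℂ}
    (hf : ContDiffOn ℝ ∞ f (annulus d r₀ r₁)) (p : ℕ) :
    Set.EqOn (genDeriv (exponent d k) (2 * p + 1) (sphereCoeff (evalReal Q) f))
      (fun v => Complex.exp (2 * p * v) * genDeriv (exponent d k) 1 (sphereCoeff (evalReal Q)
        ((Laplacian.laplacian : (EuclideanSpace ℝ (Fin d) → ℂ) →
          EuclideanSpace ℝ (Fin d) → ℂ)^[p] f)) v) (logRadii r₀ r₁) := by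
  intro v hv
  have hs := contDiffOn_iterate_laplacian (isOpen_annulus d r₀ r₁) hf p
  have h1 := genDeriv_odd_eqOn (p := 0) hs (genDeriv_even_eqOn hQ hs 0) hv
  simp only [mul_zero, zero_add, Nat.cast_zero, zero_mul, Complex.exp_zero, one_mul] at h1
  simp only
  rw [h1, genDeriv_odd_eqOn hs (genDeriv_even_eqOn hQ hf p) hv]

end GenDeriv

/-! ### Growth of the generalized derivatives. -/

section Growth

open MeasureTheory

variable {d k : ℕ} {r₀ : ℝ} {r₁ : EReal} {Q : MvPolynomial (Fin d) ℂ} {τ : ℝ}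
  {f : EuclideanSpace ℝ (Fin d) → ℂ}

lemma norm_sphereCoeff_le {y h : EuclideanSpace ℝ (Fin d) → ℂ} (hy : Continuous y) {v B : ℝ}
    (hB : ∀ x, ‖x‖ = Real.exp v → ‖h x‖ ≤ B) :
    ‖sphereCoeff y h v‖ ≤ B * ∫ θ : Metric.sphere (0 : EuclideanSpace ℝ (Fin d)) 1,
      ‖y θ‖ ∂(volume.toSphere) := by
  rw [← integral_const_mul]
  have hint : Integrable (fun θ : Metric.sphere (0 : EuclideanSpace ℝ (Fin d)) 1 => ‖y θ‖)
      (volume.toSphere) :=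
    Continuous.integrable_of_hasCompactSupport (hy.comp continuous_subtype_val).norm
      (HasCompactSupport.of_compactSpace _)
  refine norm_integral_le_of_norm_le (hint.const_mul B) (Filter.Eventually.of_forall fun θ => ?_)
  rw [norm_mul]
  gcongr
  exact hB _ (norm_exp_smul_sphere v θ)

/-- The growth of the coefficients of the iterated Laplacians. -/
lemma exists_bound_sphereCoeff_iterate (hf : IsPolyharmonicOfType (annulus d r₀ r₁) τ f)
    (Q : MvPolynomial (Fin d) ℂ) {a b : ℝ} (ha : a ∈ logRadii r₀ r₁) (hb : b ∈ logRadii r₀ r₁)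
    {ρ : ℝ} (hρ : τ < ρ) :
    ∃ C ≥ 0, ∀ p : ℕ, ∀ v ∈ Set.Icc a b, ‖sphereCoeff (evalReal Q)
        ((Laplacian.laplacian : (EuclideanSpace ℝ (Fin d) → ℂ) →
          EuclideanSpace ℝ (Fin d) → ℂ)^[p] f) v‖ ≤ C * (2 * p).factorial * ρ ^ (2 * p) := by
  set K : Set (EuclideanSpace ℝ (Fin d)) := {x | Real.exp a ≤ ‖x‖ ∧ ‖x‖ ≤ Real.exp b} with hK
  have hKG : K ⊆ annulus d r₀ r₁ := fun x hx =>
    ⟨ha.1.trans_le hx.1, (EReal.coe_le_coe_iff.2 hx.2).trans_lt hb.2⟩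
  have hKc : IsCompact K := by
    refine Metric.isCompact_of_isClosed_isBounded ?_ ?_
    · exact (isClosed_le continuous_const continuous_norm).inter
        (isClosed_le continuous_norm continuous_const)
    · refine (Metric.isBounded_closedBall (x := (0 : EuclideanSpace ℝ (Fin d)))
        (r := Real.exp b)).subset fun x hx => ?_
      simpa using hx.2
  obtain ⟨C, hC, hbd⟩ := hf.2 K hKG hKc (ρ - τ) (sub_pos.2 hρ)
  have hM : 0 ≤ ∫ θ : Metric.sphere (0 : EuclideanSpace ℝ (Fin d)) 1,
      ‖evalReal Q θ‖ ∂(volume.toSphere) := integral_nonneg fun _ => norm_nonneg _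
  refine ⟨C * ∫ θ : Metric.sphere (0 : EuclideanSpace ℝ (Fin d)) 1,
      ‖evalReal Q θ‖ ∂(volume.toSphere), mul_nonneg hC.le hM, fun p v hv => ?_⟩
  refine (norm_sphereCoeff_le (contDiff_evalReal Q).continuous
    (B := C * (2 * p).factorial * ρ ^ (2 * p)) fun x hx => ?_).trans_eq (by ring)
  have := hbd p x ⟨by rw [hx]; exact Real.exp_le_exp.2 hv.1, by rw [hx]; exact Real.exp_le_exp.2 hv.2⟩
  rwa [add_sub_cancel] at this

/-- Because `Φ_1(0) = 0` and `Φ_1'(0) = Φ_0(0) = 1`, the zero is isolated. The interpolation divides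
by `Φ_1(δ)`. -/
lemma exists_fundamentalFunction_one_ne_zero (lam : ℕ → ℂ) {η : ℝ} (hη : 0 < η) :
    ∃ δ : ℝ, 0 < δ ∧ δ < η ∧ fundamentalFunction lam 1 (δ : ℂ) ≠ 0 := by
  have h := (hasDerivAt_fundamentalFunction_succ lam 0 ((0 : ℝ) : ℂ)).comp_ofReal
  have hne : lam (0 + 1) * fundamentalFunction lam (0 + 1) ((0 : ℝ) : ℂ) +
      fundamentalFunction lam 0 ((0 : ℝ) : ℂ) ≠ 0 := by
    simp [fundamentalFunction_succ_apply_zero lam 0, fundamentalFunction_zero]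
  have hsub : Set.Ioi (0 : ℝ) ⊆ {0}ᶜ := fun x hx => ne_of_gt hx
  have hev := (h.eventually_ne hne (c := 0)).filter_mono (nhdsWithin_mono (0 : ℝ) hsub)
  obtain ⟨δ, h1, h2⟩ := (hev.and (Ioo_mem_nhdsGT hη)).exists
  exact ⟨δ, h2.1, h2.2, h1⟩

/-- The growth of the first generalized derivatives, by interpolation between the orders zero
and two. -/
lemma exists_bound_genDeriv_one (hf : IsPolyharmonicOfType (annulus d r₀ r₁) τ f)
    (hQ : Q ∈ harmonicHomogeneous d k) {a b : ℝ} (ha : a ∈ logRadii r₀ r₁)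
    (hb : b ∈ logRadii r₀ r₁) {ρ : ℝ} (hτ : 0 ≤ τ) (hρ : τ < ρ) :
    ∃ C ≥ 0, ∀ p : ℕ, ∀ v ∈ Set.Icc a b, ‖genDeriv (exponent d k) 1 (sphereCoeff (evalReal Q)
        ((Laplacian.laplacian : (EuclideanSpace ℝ (Fin d) → ℂ) →
          EuclideanSpace ℝ (Fin d) → ℂ)^[p] f)) v‖ ≤
      C * ((2 * p).factorial * ρ ^ (2 * p) + (2 * p + 2).factorial * ρ ^ (2 * p + 2)) := by
  -- The interval is enlarged beyond `b` so that the second interpolation node `v + δ` stays in the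
  -- domain.
  obtain ⟨η, hη, hηb⟩ := Metric.isOpen_iff.1 (isOpen_logRadii r₀ r₁) b hb
  set lam := exponent d k with hlam
  obtain ⟨δ, hδ, hδη, hΦ⟩ := exists_fundamentalFunction_one_ne_zero lam hη
  have hbδ : b + δ ∈ logRadii r₀ r₁ := hηb (by simpa [abs_of_pos hδ] using hδη)
  have hsub := Icc_subset_logRadii ha hbδ
  obtain ⟨C, hC, hbd⟩ := exists_bound_sphereCoeff_iterate hf Q ha hbδ hρ
  set β : ℝ := (k : ℝ) + d + 2 with hβ
  have hβ0 : 0 ≤ β := by positivity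
  set m := Real.exp (β * δ) * (Real.exp δ - 1) with hm
  have hδ1 : 0 ≤ Real.exp δ - 1 := by linarith [Real.add_one_le_exp δ]
  have hm0 : 0 ≤ m := by positivity
  have hρ0 : 0 < ρ := hτ.trans_lt hρ
  set c := ‖fundamentalFunction lam 1 (δ : ℂ)‖ with hc
  have hc0 : 0 < c := norm_pos_iff.2 hΦ
  set e := ‖fundamentalFunction lam 0 (δ : ℂ)‖ with he
  have he0 : 0 ≤ e := norm_nonneg _
  refine ⟨C * (1 + e + Real.exp (2 * (b + δ)) * m * δ) / c, by positivity, fun p v hv => ?_⟩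
  set u := (Laplacian.laplacian : (EuclideanSpace ℝ (Fin d) → ℂ) →
          EuclideanSpace ℝ (Fin d) → ℂ)^[p] f with hu
  have hus : ContDiffOn ℝ ∞ u (annulus d r₀ r₁) :=
    contDiffOn_iterate_laplacian (isOpen_annulus d r₀ r₁) hf.1 p
  set X := (2 * p).factorial * ρ ^ (2 * p) with hX
  set Z := (2 * p + 2).factorial * ρ ^ (2 * p + 2) with hZ
  have hX0 : 0 ≤ X := by positivity
  have hZ0 : 0 ≤ Z := by positivity
  have hmem : Set.uIcc v (v + δ) ⊆ Set.Icc a (b + δ) := by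
    rw [Set.uIcc_of_le (by linarith)]
    exact Set.Icc_subset_Icc hv.1 (by linarith [hv.2])
  -- First-order expansion at `v` with step `δ`: the remainder contains `D^(2)`, that is `e^{2t}`
  -- times the coefficient of `Δ^{p+1} f`, whence `Z`.
  have hrem := norm_sub_sum_genDeriv_mul_le (lam := lam) (g := sphereCoeff (evalReal Q) u)
    (s := v) (v := v + δ) (N := 1) (C := Real.exp (2 * (b + δ)) * (C * Z) * m)
    (fun n _ t ht => differentiableAt_genDeriv hQ hus n (hsub (hmem ht))) (fun t ht => by
      have ht' := hmem ht
      have h2 := genDeriv_even_eqOn hQ hus 1 (hsub ht')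
      have h3 := hbd (p + 1) t ht'
      rw [Function.iterate_succ_apply', ← hu] at h3
      simp only [Function.iterate_one] at h2
      change genDeriv lam (1 + 1) _ t = _ at h2
      rw [h2, norm_mul, norm_mul]
      have h4 : ‖Complex.exp (2 * (1 : ℕ) * t)‖ ≤ Real.exp (2 * (b + δ)) := by
        rw [Complex.norm_exp]
        refine Real.exp_le_exp.2 ?_
        simp
        exact ht'.2
      have h5 : ‖(((v + δ : ℝ) : ℂ) - t)‖ ≤ δ := by
        rw [← Complex.ofReal_sub, Complex.norm_real, Real.norm_eq_abs, abs_le]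
        rw [Set.uIcc_of_le (by linarith)] at ht
        constructor <;> linarith [ht.1, ht.2]
      have h6 : ‖fundamentalFunction lam 1 (((v + δ : ℝ) : ℂ) - t)‖ ≤ m := by
        refine (norm_fundamentalFunction_le (norm_exponent_le d k) 1 _).trans ?_
        have h7 : 0 ≤ Real.exp ‖(((v + δ : ℝ) : ℂ) - t)‖ - 1 := by
          linarith [Real.add_one_le_exp ‖(((v + δ : ℝ) : ℂ) - t)‖,
            norm_nonneg (((v + δ : ℝ) : ℂ) - t)]
        simp only [pow_one, Nat.factorial_one, Nat.cast_one, div_one]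
        rw [hm]
        gcongr
      have h8 : C * (2 * (p + 1)).factorial * ρ ^ (2 * (p + 1)) = C * Z := by
        rw [hZ, mul_assoc]; rfl
      rw [h8] at h3
      gcongr)
  have hδ' : (((v + δ : ℝ) : ℂ) - v) = δ := by push_cast; ring
  rw [hδ', add_sub_cancel_left, abs_of_pos hδ] at hrem
  simp only [Finset.sum_range_succ, Finset.sum_range_zero, zero_add] at hrem
  have hg0 : genDeriv lam 0 (sphereCoeff (evalReal Q) u) v = sphereCoeff (evalReal Q) u v := rfl
  rw [hg0] at hrem
  have hb1 : ‖sphereCoeff (evalReal Q) u v‖ ≤ C * X := by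
    have := hbd p v (hmem Set.left_mem_uIcc)
    rwa [mul_assoc] at this
  have hb2 : ‖sphereCoeff (evalReal Q) u (v + δ)‖ ≤ C * X := by
    have := hbd p (v + δ) (hmem Set.right_mem_uIcc)
    rwa [mul_assoc] at this
  set w := genDeriv lam 1 (sphereCoeff (evalReal Q) u) v with hw
  -- The expansion is solved for `w Φ_1(δ)`.
  have key : ‖w‖ * c ≤ C * X + C * X * e + Real.exp (2 * (b + δ)) * (C * Z) * m * δ := by
    rw [hc, ← norm_mul]
    have hdecomp : w * fundamentalFunction lam 1 δ = sphereCoeff (evalReal Q) u (v + δ) -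
        sphereCoeff (evalReal Q) u v * fundamentalFunction lam 0 δ -
        (sphereCoeff (evalReal Q) u (v + δ) - (sphereCoeff (evalReal Q) u v *
          fundamentalFunction lam 0 δ + w * fundamentalFunction lam 1 δ)) := by ring
    rw [hdecomp]
    refine (norm_sub_le _ _).trans (add_le_add ((norm_sub_le _ _).trans
      (add_le_add hb2 ?_)) hrem)
    rw [norm_mul]
    gcongr
  rw [div_mul_eq_mul_div, le_div_iff₀ hc0]
  refine key.trans ?_
  have hS : 0 ≤ Real.exp (2 * (b + δ)) * m * δ := by positivity
  nlinarith [mul_nonneg hC hZ0, mul_nonneg (mul_nonneg hC hZ0) he0,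
    mul_nonneg (mul_nonneg hC hX0) hS]

/-- Passing from orders `n` and `n + 2` to the order between them costs a factor linear in `n`,
which `(σ/ρ)^n` absorbs. -/
lemma exists_factorial_pow_bound {σ ρ : ℝ} (hσ : 0 < σ) (hσρ : σ < ρ) :
    ∃ B ≥ 0, ∀ n : ℕ, (n.factorial : ℝ) * σ ^ n + (n + 2).factorial * σ ^ (n + 2) ≤
      B * ((n + 1).factorial * ρ ^ (n + 1)) := by
  have hρ : 0 < ρ := hσ.trans hσρ
  set q := σ / ρ with hq
  have hq0 : 0 ≤ q := by positivity
  have hq1 : q < 1 := (div_lt_one hρ).2 hσρ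
  have hlim : Filter.Tendsto (fun n : ℕ => (1 + ((n : ℝ) + 2) * σ ^ 2) * q ^ n) Filter.atTop
      (nhds 0) := by
    have h1 := ((tendsto_self_mul_const_pow_of_lt_one hq0 hq1).const_mul (σ ^ 2)).add
      ((tendsto_pow_atTop_nhds_zero_of_lt_one hq0 hq1).const_mul (1 + 2 * σ ^ 2))
    rw [mul_zero, mul_zero, add_zero] at h1
    exact h1.congr fun n => by ring
  obtain ⟨M, hM⟩ := hlim.bddAbove_range
  have hM' : ∀ n : ℕ, (1 + ((n : ℝ) + 2) * σ ^ 2) * q ^ n ≤ M := fun n => hM ⟨n, rfl⟩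
  have hM0 : 0 ≤ M := by
    refine le_trans ?_ (hM' 0)
    positivity
  refine ⟨M / ρ, by positivity, fun n => ?_⟩
  have hqn : q ^ n * ρ ^ n = σ ^ n := by
    rw [← mul_pow, hq, div_mul_cancel₀ _ hρ.ne']
  have hfac : (n.factorial : ℝ) ≤ (n + 1).factorial := by
    exact_mod_cast Nat.factorial_le (Nat.le_succ n)
  calc (n.factorial : ℝ) * σ ^ n + (n + 2).factorial * σ ^ (n + 2)
      ≤ (n + 1).factorial * σ ^ n + (n + 2).factorial * σ ^ (n + 2) := by gcongr
    _ = (n + 1).factorial * ρ ^ n * ((1 + ((n : ℝ) + 2) * σ ^ 2) * q ^ n) := by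
        rw [Nat.factorial_succ (n + 1), pow_add, ← hqn]
        push_cast
        ring
    _ ≤ (n + 1).factorial * ρ ^ n * M := by gcongr; exact hM' n
    _ = _ := by
        rw [pow_succ]
        field_simp

/-- The growth of the generalized derivatives of the coefficients. -/
lemma exists_bound_genDeriv (hf : IsPolyharmonicOfType (annulus d r₀ r₁) τ f)
    (hQ : Q ∈ harmonicHomogeneous d k) {a b : ℝ} (ha : a ∈ logRadii r₀ r₁)
    (hb : b ∈ logRadii r₀ r₁) (hτ : 0 ≤ τ) {ρ : ℝ} (hρ : τ < ρ) :
    ∃ C ≥ 0, ∀ n : ℕ, ∀ v ∈ Set.Icc a b,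
      ‖genDeriv (exponent d k) n (sphereCoeff (evalReal Q) f) v‖ ≤
        C * n.factorial * (Real.exp v * ρ) ^ n := by
  -- Odd orders are estimated at the smaller rate `σ`, leaving room for the loss in the
  -- interpolation.
  obtain ⟨σ, hτσ, hσρ⟩ := exists_between hρ
  have hσ0 : 0 < σ := hτ.trans_lt hτσ
  have hρ0 : 0 < ρ := hσ0.trans hσρ
  have hsub := Icc_subset_logRadii ha hb
  obtain ⟨C₀, hC₀, h₀⟩ := exists_bound_sphereCoeff_iterate hf Q ha hb hρ
  obtain ⟨C₁, hC₁, h₁⟩ := exists_bound_genDeriv_one hf hQ ha hb hτ hτσ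
  obtain ⟨B, hB, hfac⟩ := exists_factorial_pow_bound hσ0 hσρ
  have hexp : ∀ (p : ℕ) (v : ℝ), ‖Complex.exp (2 * p * v)‖ = Real.exp v ^ (2 * p) := by
    intro p v
    rw [Complex.norm_exp, ← Real.exp_nat_mul]
    congr 1
    simp
  -- The factor `e^{-a} ≥ e^{-v}` turns `e^{2pv}` into `e^{(2p+1)v}` for odd orders.
  refine ⟨C₀ + C₁ * B * Real.exp (-a), by positivity, fun n v hv => ?_⟩
  obtain ⟨p, rfl | rfl⟩ := n.even_or_odd'
  · rw [genDeriv_even_eqOn hQ hf.1 p (hsub hv), norm_mul, hexp]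
    calc _ ≤ Real.exp v ^ (2 * p) * (C₀ * (2 * p).factorial * ρ ^ (2 * p)) := by
          gcongr
          exact h₀ p v hv
      _ = C₀ * (2 * p).factorial * (Real.exp v * ρ) ^ (2 * p) := by rw [mul_pow]; ring
      _ ≤ _ := by
          gcongr
          exact le_add_of_nonneg_right (by positivity)
  · rw [genDeriv_odd_eqOn_genDeriv_one hQ hf.1 p (hsub hv), norm_mul, hexp]
    calc _ ≤ Real.exp v ^ (2 * p) * (C₁ * (B * ((2 * p + 1).factorial * ρ ^ (2 * p + 1)))) := by
          gcongr
          exact (h₁ p v hv).trans (by gcongr; exact hfac (2 * p))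
      _ = C₁ * B * Real.exp (-v) * (2 * p + 1).factorial * (Real.exp v * ρ) ^ (2 * p + 1) := by
          rw [mul_pow, pow_succ (Real.exp v), Real.exp_neg]
          field_simp
      _ ≤ C₁ * B * Real.exp (-a) * (2 * p + 1).factorial * (Real.exp v * ρ) ^ (2 * p + 1) := by
          have : Real.exp (-v) ≤ Real.exp (-a) := Real.exp_le_exp.2 (neg_le_neg hv.1)
          gcongr
      _ ≤ _ := by
          gcongr
          exact le_add_of_nonneg_left hC₀

end Growth

/-! ### Transfer to the Fourier-Laplace coefficients. -/

lemma fourierLaplaceCoeff_exp {d : ℕ} (f : EuclideanSpace ℝ (Fin d) → ℂ)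
    {P Q : MvPolynomial (Fin d) ℂ} (h : ∀ x, (starRingEnd ℂ) (evalReal P x) = evalReal Q x) :
    (fun v => fourierLaplaceCoeff f P (Real.exp v)) = sphereCoeff (evalReal Q) f := by
  ext v
  simp only [fourierLaplaceCoeff, sphereCoeff, h]

lemma exists_mem_logRadii {r₀ : ℝ} {r₁ : EReal} (hr₀ : 0 ≤ r₀) (hr : (r₀ : EReal) < r₁) :
    ∃ v, v ∈ logRadii r₀ r₁ := by
  obtain ⟨r, h1, h2⟩ := EReal.exists_between_coe_real hr
  have h1' : r₀ < r := EReal.coe_lt_coe_iff.1 h1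
  refine ⟨Real.log r, ?_⟩
  unfold logRadii
  rw [Set.mem_ofPred_eq, Real.exp_log (hr₀.trans_lt h1')]
  exact ⟨h1', h2⟩

lemma uIcc_subset_logRadii {r₀ : ℝ} {r₁ : EReal} {a b : ℝ} (ha : a ∈ logRadii r₀ r₁)
    (hb : b ∈ logRadii r₀ r₁) : Set.uIcc a b ⊆ logRadii r₀ r₁ := by
  rcases le_total a b with h | h
  · rw [Set.uIcc_of_le h]
    exact Icc_subset_logRadii ha hb
  · rw [Set.uIcc_of_ge h]
    exact Icc_subset_logRadii hb ha

end Polyharmonic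

end

theorem mainTheorem1 (d : ℕ) (hd : 2 ≤ d) (r₀ : ℝ) (r₁ : EReal) (hr₀ : 0 ≤ r₀)
    (hr : (r₀ : EReal) < r₁)
    (Y : ∀ k : ℕ, Module.Basis (Fin (Polyharmonic.harmonicDim d k)) ℂ
      (Polyharmonic.harmonicHomogeneous d k))
    (hY : ∀ (k : ℕ) (l m : Fin (Polyharmonic.harmonicDim d k)),
      Polyharmonic.sphereInner (Y k l : MvPolynomial (Fin d) ℂ) (Y k m) = if l = m then 1 else 0)
    (τ : ℝ) (hτ : 0 ≤ τ) (f : EuclideanSpace ℝ (Fin d) → ℂ)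
    (hf : Polyharmonic.IsPolyharmonicOfType (Polyharmonic.annulus d r₀ r₁) τ f)
    (k : ℕ) (l : Fin (Polyharmonic.harmonicDim d k))
    (fkl : ℝ → ℂ) (hfkl : fkl = Polyharmonic.fourierLaplaceCoeff f (Y k l))
    (ftilde : ℝ → ℂ) (hftilde : ftilde = fun v => fkl (Real.exp v)) :
    (∀ v₀ : ℝ, r₀ < Real.exp v₀ → ((Real.exp v₀ : ℝ) : EReal) < r₁ →
      -- absolute convergence in the disc
      (∀ z ∈ Polyharmonic.convergenceDisc τ v₀,
        Summable fun n => ‖Polyharmonic.taylorTerm (Polyharmonic.exponent d k) ftilde v₀ n z‖) ∧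
      -- uniform convergence on the compact subsets of the disc
      (∀ K ⊆ Polyharmonic.convergenceDisc τ v₀, IsCompact K →
        TendstoUniformlyOn
          (fun (N : ℕ) (z : ℂ) => ∑ n ∈ Finset.range N,
            Polyharmonic.taylorTerm (Polyharmonic.exponent d k) ftilde v₀ n z)
          (fun z => ∑' n, Polyharmonic.taylorTerm (Polyharmonic.exponent d k) ftilde v₀ n z)
          Filter.atTop K) ∧
      -- the sum is analytic in the disc and extends `ftilde`
      AnalyticOnNhd ℂ
        (fun z => ∑' n, Polyharmonic.taylorTerm (Polyharmonic.exponent d k) ftilde v₀ n z)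
        (Polyharmonic.convergenceDisc τ v₀) ∧
      (∀ v : ℝ, r₀ < Real.exp v → ((Real.exp v : ℝ) : EReal) < r₁ →
        (v : ℂ) ∈ Polyharmonic.convergenceDisc τ v₀ →
        ∑' n, Polyharmonic.taylorTerm (Polyharmonic.exponent d k) ftilde v₀ n (v : ℂ) =
          ftilde v)) ∧
    (τ = 0 →
      -- `ftilde` is the restriction of an entire function
      (∃ F : ℂ → ℂ, AnalyticOnNhd ℂ F Set.univ ∧
        ∀ v : ℝ, r₀ < Real.exp v → ((Real.exp v : ℝ) : EReal) < r₁ → F (v : ℂ) = ftilde v) ∧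
      -- `fkl` extends to the complex plane cut along the half line `(-∞, 0]`
      (∃ H : ℂ → ℂ, AnalyticOnNhd ℂ H Complex.slitPlane ∧
        ∀ r : ℝ, r₀ < r → (r : EReal) < r₁ → H (r : ℂ) = fkl r)) := by
  -- The conjugate in the coefficient is absorbed into another harmonic polynomial of the same
  -- degree.
  obtain ⟨Q, hQ, hconj⟩ := Polyharmonic.exists_conj_evalReal (Y k l).2
  have hft : ftilde = Polyharmonic.sphereCoeff (Polyharmonic.evalReal Q) f := by
    rw [hftilde, hfkl]
    exact Polyharmonic.fourierLaplaceCoeff_exp f hconj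
  have hb := Polyharmonic.norm_exponent_le d k
  have hb0 : (0 : ℝ) ≤ (k : ℝ) + d + 2 := by positivity
  have part1 : ∀ v₀ ∈ Polyharmonic.logRadii r₀ r₁,
      (∀ ρ > τ, ∃ C ≥ 0, ∀ n, ‖Polyharmonic.genDeriv (Polyharmonic.exponent d k) n ftilde v₀‖ ≤
        C * n.factorial * (Real.exp v₀ * ρ) ^ n) ∧
      ∀ v ∈ Polyharmonic.logRadii r₀ r₁, (v : ℂ) ∈ Polyharmonic.convergenceDisc τ v₀ →
        ∑' n, Polyharmonic.taylorTerm (Polyharmonic.exponent d k) ftilde v₀ n (v : ℂ) =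
          ftilde v := by
    intro v₀ hv₀
    rw [hft]
    refine ⟨fun ρ hρ => ?_, fun v hv hvd => ?_⟩
    · obtain ⟨C, hC, h⟩ := Polyharmonic.exists_bound_genDeriv hf hQ hv₀ hv₀ hτ hρ
      exact ⟨C, hC, fun n => h n v₀ ⟨le_rfl, le_rfl⟩⟩
    · have hsub := Polyharmonic.uIcc_subset_logRadii hv₀ hv
      refine Polyharmonic.tsum_taylorTerm_eq hb hb0 hτ hvd
        (fun n t ht => Polyharmonic.differentiableAt_genDeriv hQ hf.1 n (hsub ht)) fun ρ hρ => ?_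
      have hmin : min v₀ v ∈ Polyharmonic.logRadii r₀ r₁ := hsub ⟨le_rfl, min_le_max⟩
      have hmax : max v₀ v ∈ Polyharmonic.logRadii r₀ r₁ := hsub ⟨min_le_max, le_rfl⟩
      obtain ⟨C, hC, h⟩ := Polyharmonic.exists_bound_genDeriv hf hQ hmin hmax hτ hρ
      exact ⟨C, hC, fun n t ht => h n t ht⟩
  refine ⟨fun v₀ h₀ h₁ => ?_, fun hτ0 => ?_⟩
  · obtain ⟨hD, heq⟩ := part1 v₀ ⟨h₀, h₁⟩
    exact ⟨fun z hz => Polyharmonic.summable_norm_taylorTerm hb hb0 hτ hD hz,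
      fun K hK hKc => Polyharmonic.tendstoUniformlyOn_taylorSeries hb hb0 hτ hD hK hKc,
      Polyharmonic.analyticOnNhd_taylorSeries hb hb0 hτ hD,
      fun v hv hv' hvd => heq v ⟨hv, hv'⟩ hvd⟩
  -- For `τ = 0` one center suffices: its disc is the whole plane, so its series is the entire
  -- extension.
  · obtain ⟨v₀, hv₀⟩ := Polyharmonic.exists_mem_logRadii hr₀ hr
    obtain ⟨hD, heq⟩ := part1 v₀ hv₀
    have hdisc : Polyharmonic.convergenceDisc τ v₀ = Set.univ := by
      simp [Polyharmonic.convergenceDisc, hτ0]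
    have han := Polyharmonic.analyticOnNhd_taylorSeries hb hb0 hτ hD
    rw [hdisc] at han heq
    refine ⟨⟨_, han, fun v hv hv' => heq v ⟨hv, hv'⟩ trivial⟩, _,
      han.comp (t := Set.univ) (f := Complex.log) (fun z hz => analyticAt_clog hz)
        (Set.mapsTo_univ _ _), fun r hr hr' => ?_⟩
    have hr_pos : 0 < r := hr₀.trans_lt hr
    have hlog : Real.exp (Real.log r) = r := Real.exp_log hr_pos
    have := heq (Real.log r) ⟨by rwa [hlog], by rwa [hlog]⟩ trivial
    rw [hftilde] at this
    simp only [hlog] at this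
    rw [← this, Function.comp_apply, Complex.ofReal_log hr_pos.le, hftilde]
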